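/- **Notation.** Fix a norm $\|\cdot\|$ on $\mathbb R^d$, $d\ge 1$, and give $\mathbb R^d\times\mathbb R^d$ the norm $\max(\|x\|,\|y\|)$; $B(0,r)$ and $\overline B(0,r)$ are the open and closed balls in $\mathbb R^d$. For a map $\phi$ that is $C^\ell$ near $S$ put $\|\phi\|_{S,\ell}=\sup_{x\in S}\|D^\ell\phi(x)\|_{op}\in[0,\infty]$. For a smooth Riemannian manifold $(N,h)$, $\exp_h\colon D_h\to N$ denotes the Riemannian exponential map on its maximal domain $D_h\subseteq TN$. If $h$ is a Riemannian metric on an open set $U\subseteq\mathbb R^d$ (so $TU=U\times\mathbb R^d$) and $K$ is relatively compact in $U$, let $\tau_h(K)\in\,]0,\infty]$ be the supremum of all $\tau>0$ with $\overline K\times B(0,\tau)\subseteq D_h$, and for $0<\delta<\tau_h(K)$ let $$B^1_h(K,\delta)=\sup_{x\in\overline K}\|\exp_h(x,\cdot)\|_{\overline B(0,\delta),1},\qquad B^2_h(K,\delta)=\|\exp_h\|_{\overline K\times\overline B(0,\delta),2}.$$ For a chart $\kappa\colon\widetilde U_\kappa\to U_\kappa$ of $M$, a metric $g$ and a vector field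 $X$ on $M$, the localizations are $g_\kappa=g\circ(T\kappa^{-1}\oplus T\kappa^{-1})$ and $X_\kappa=d\kappa\circ X\circ\kappa^{-1}\colon U_\kappa\to\mathbb R^d$. **Statement.** Let $(M,g)$ be a smooth (Hausdorff) $d$-dimensional Riemannian manifold and $\mathcal A=\{\kappa\colon\widetilde U_\kappa\to U_\kappa\}$ an atlas of smooth charts of $M$. For each $\kappa\in\mathcal A$ let $r_\kappa>0$ with $\overline B(0,r_\kappa)\subseteq U_\kappa$, such that the sets $\kappa^{-1}(B(0,r_\kappa))$ cover $M$; let $0<\nu_\kappa<\tau_{g_\kappa}(B(0,r_\kappa))$ and $0<\varepsilon_\kappa<\tfrac12$. Let $k\in\{1,2,\dots\}\cup\{\infty\}$ and let $X$ be a $C^k$ vector field on $M$ such that for every $\kappa\in\mathcal A$ $$\|X_\kappa\|_{B(0,r_\kappa),0}<\min\Bigl(\frac{\varepsilon_\kappa r_\kappa}{2B^1_{g_\kappa}(B(0,r_\kappa),\nu_\kappa)},\ \nu_\kappa,\ \frac{\varepsilon_\kappa}{4\,(B^2_{g_\kappa}(B(0,r_\kappa),\nu_\kappa)+1)}\Bigr),\qquad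 \|X_\kappa\|_{B(0,r_\kappa),1}<\frac{\varepsilon_\kappa}{4}.$$ Then: 1. The image of $X$ lies in $D_g$. The map $\phi_X=\exp_g\circ X\colon M\to M$ maps each connected component of $M$ into itself. For each $\kappa\in\mathcal A$, $\phi_X$ maps $\kappa^{-1}(B(0,r_\kappa))$ into $\widetilde U_\kappa$, and $\kappa\circ\phi_X\circ\kappa^{-1}$ restricted to $B(0,r_\kappa)$ is a $C^k$-diffeomorphism onto an open subset of $\mathbb R^d$ that contains $B(0,r_\kappa(1-2\varepsilon_\kappa))$. 2. For each $y\in M$, $\#\phi_X^{-1}(y)\le\#\mathcal A_y$, where $\mathcal A_y=\{\kappa\in\mathcal A: y\in\widetilde U_\kappa\}$. Assume in addition that $M$ is connected, that the cover $(\widetilde U_\kappa)_{\kappa\in\mathcal A}$ is locally finite, and that $\widetilde r_\kappa$, $\kappa\in\mathcal A$, are real numbers such that the sets $\kappa^{-1}(B(0,\widetilde r_\kappa))$ also cover $M$. 3. If $\widetilde r_\kappa<(1-\varepsilon_\kappa)r_\kappa$ for all $\kappa$, then $\phi_X$ is a proper map. 4. If $\widetilde r_\kappa<(1-2\varepsilon_\kappa)r_\kappa$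 for all $\kappa$, then $\phi_X$ is a covering map with finitely many sheets: there is an integer $n\ge1$ such that every point of $M$ has exactly $n$ preimages. 5. If, in the situation of 4, some point of $M$ lies in exactly one of the chart domains $\widetilde U_\kappa$, then $\phi_X$ is a $C^k$-diffeomorphism of $M$ onto itself. -/

import Mathlib

open Set Bundle
open scoped Manifold ContDiff ENNReal Topology

universe u v w

noncomputable section

/-! ### Geodesics and the exponential map on open subsets of a normed space -/

section Local

variable {E : Type*} [NormedAddCommGroup E] [NormedSpace ℝ E]

/-- The Christoffel symbols of the first kind of a metric `G` on an open subset of `E`: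
`Γ_x(u, v; w) = ½ (∂_u G(v, w) + ∂_v G(u, w) - ∂_w G(u, v))` at the point `x`. -/
def christoffelFirst (G : E → E →L[ℝ] E →L[ℝ] ℝ) (x u v w : E) : ℝ :=
  (1 / 2) * (fderiv ℝ G x u v w + fderiv ℝ G x v u w - fderiv ℝ G x w u v)

/-- The geodesic equation at time `t`, with the upper index lowered by the metric:
`G(γ'', w) + Γ(γ', γ'; w) = 0` for all `w`. -/
def GeodesicEqAt (G : E → E →L[ℝ] E →L[ℝ] ℝ) (γ : ℝ → E) (t : ℝ) : Prop :=
  ∀ w : E, G (γ t) (deriv (deriv γ) t) w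
    + christoffelFirst G (γ t) (deriv γ t) (deriv γ t) w = 0

/-- `γ` is, on an open interval around `[0, 1]`, a geodesic of the Riemannian manifold `(U, G)`,
`U` an open subset of `E`, that starts in `p.1` with velocity `p.2`. -/
def IsGeodesicFromIn (G : E → E →L[ℝ] E →L[ℝ] ℝ) (U : Set E) (p : E × E) (γ : ℝ → E) : Prop :=
  γ 0 = p.1 ∧ deriv γ 0 = p.2 ∧
  ∃ δ : ℝ, 0 < δ ∧ MapsTo γ (Ioo (-δ) (1 + δ)) U ∧ ContDiffOn ℝ 2 γ (Ioo (-δ) (1 + δ)) ∧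
    ∀ t ∈ Ioo (-δ) (1 + δ), GeodesicEqAt G γ t

/-- The maximal domain of the Riemannian exponential map of `(U, G)`, where `TU = U × E`. -/
def expDomainIn (G : E → E →L[ℝ] E →L[ℝ] ℝ) (U : Set E) : Set (E × E) :=
  {p | ∃ γ : ℝ → E, IsGeodesicFromIn G U p γ}

open Classical in
/-- The Riemannian exponential map of `(U, G)`: the value at time `1` of the geodesic with the
given initial position and velocity (outside of the domain, the base point). -/
def expIn (G : E → E →L[ℝ] E →L[ℝ] ℝ) (U : Set E) (p : E × E) : E :=
  if h : ∃ γ : ℝ → E, IsGeodesicFromIn G U p γ then h.choose 1 else p.1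

/-- The supremum, in `[0, ∞]`, of all `τ > 0` such that `closure K × ball 0 τ` is contained in the
domain of the exponential map of `(U, G)`. -/
def expRadius (G : E → E →L[ℝ] E →L[ℝ] ℝ) (K U : Set E) : ℝ≥0∞ :=
  ⨆ (τ : ℝ) (_ : 0 < τ ∧ closure K ×ˢ Metric.ball (0 : E) τ ⊆ expDomainIn G U), ENNReal.ofReal τ

/-- The quasinorm `sup_{x ∈ S} ‖D^ℓ φ(x)‖ ∈ [0, ∞]`, for `φ` defined and `C^ℓ` on a neighborhood
of `S`. -/
def supNormDeriv {F F' : Type*} [NormedAddCommGroup F] [NormedSpace ℝ F]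
    [NormedAddCommGroup F'] [NormedSpace ℝ F'] (φ : F → F') (S : Set F) (ℓ : ℕ) : ℝ≥0∞ :=
  ⨆ x ∈ S, ‖iteratedFDeriv ℝ ℓ φ x‖ₑ

/-- `sup_{x ∈ closure K} sup_{‖y‖ ≤ δ} ‖D(exp_x)(y)‖`. -/
def expBoundFst (G : E → E →L[ℝ] E →L[ℝ] ℝ) (K U : Set E) (δ : ℝ) : ℝ≥0∞ :=
  ⨆ x ∈ closure K, supNormDeriv (fun y : E => expIn G U (x, y)) (Metric.closedBall 0 δ) 1

/-- `sup ‖D² exp‖` over `closure K × closedBall 0 δ`; the norm on `E × E` is the maximum norm. -/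
def expBoundSnd (G : E → E →L[ℝ] E →L[ℝ] ℝ) (K U : Set E) (δ : ℝ) : ℝ≥0∞ :=
  supNormDeriv (expIn G U) (closure K ×ˢ Metric.closedBall 0 δ) 2

end Local

/-! ### Riemannian manifolds -/

section Global

variable {E : Type*} [NormedAddCommGroup E] [NormedSpace ℝ E]
  {M : Type*} [TopologicalSpace M] [ChartedSpace E M] [IsManifold 𝓘(ℝ, E) ∞ M]

/-- The localization `dκ ∘ X ∘ κ⁻¹` of a vector field `X` in the chart `κ`. -/
def localVectorField (κ : OpenPartialHomeomorph M E) (X : ∀ x : M, TangentSpace 𝓘(ℝ, E) x)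
    (y : E) : E :=
  mfderiv 𝓘(ℝ, E) 𝓘(ℝ, E) κ (κ.symm y) (X (κ.symm y))

/-- A smooth Riemannian metric on `M`. -/
abbrev SmoothMetric (E : Type*) [NormedAddCommGroup E] [NormedSpace ℝ E]
    (M : Type*) [TopologicalSpace M] [ChartedSpace E M] [IsManifold 𝓘(ℝ, E) ∞ M] :=
  ContMDiffRiemannianMetric 𝓘(ℝ, E) ∞ E (fun x : M => TangentSpace 𝓘(ℝ, E) x)

/-- The localization `g ∘ (Tκ⁻¹ ⊕ Tκ⁻¹)` of a Riemannian metric `g` in the chart `κ`,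
a Riemannian metric on `κ.target`. -/
def localMetric (g : SmoothMetric E M) (κ : OpenPartialHomeomorph M E) (y : E) :
    E →L[ℝ] E →L[ℝ] ℝ :=
  let B : E →L[ℝ] E →L[ℝ] ℝ := g.inner (κ.symm y)
  let A : E →L[ℝ] E := mfderiv 𝓘(ℝ, E) 𝓘(ℝ, E) κ.symm y
  B.bilinearComp A A

/-- `γ` is a geodesic of `(M, g)` on the open interval `J`: it is `C²` and satisfies the geodesic
equation in every chart of `M`. -/
def IsGeodesicOn (g : SmoothMetric E M) (γ : ℝ → M) (J : Set ℝ) : Prop :=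
  ContMDiffOn 𝓘(ℝ, ℝ) 𝓘(ℝ, E) 2 γ J ∧
  ∀ κ ∈ IsManifold.maximalAtlas 𝓘(ℝ, E) ∞ M, ∀ t ∈ J, γ t ∈ κ.source →
    GeodesicEqAt (localMetric g κ) (κ ∘ γ) t

/-- `γ` is, on an open interval around `[0, 1]`, a geodesic of `(M, g)` with `γ'(0) = v`. -/
def IsGeodesicFrom (g : SmoothMetric E M) (v : TangentBundle 𝓘(ℝ, E) M) (γ : ℝ → M) : Prop :=
  tangentMap 𝓘(ℝ, ℝ) 𝓘(ℝ, E) γ ⟨0, (1 : ℝ)⟩ = v ∧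
  ∃ δ : ℝ, 0 < δ ∧ IsGeodesicOn g γ (Ioo (-δ) (1 + δ))

/-- The maximal domain of the Riemannian exponential map of `(M, g)`. -/
def expDomain (g : SmoothMetric E M) : Set (TangentBundle 𝓘(ℝ, E) M) :=
  {v | ∃ γ : ℝ → M, IsGeodesicFrom g v γ}

open Classical in
/-- The Riemannian exponential map of `(M, g)` (outside of its domain, the base point). -/
def riemannExp (g : SmoothMetric E M) (v : TangentBundle 𝓘(ℝ, E) M) : M :=
  if h : ∃ γ : ℝ → M, IsGeodesicFrom g v γ then h.choose 1 else v.proj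

/-- The map `exp_g ∘ X`. -/
def expField (g : SmoothMetric E M) (X : ∀ x : M, TangentSpace 𝓘(ℝ, E) x) (x : M) : M :=
  riemannExp g ⟨x, X x⟩

end Global

end

/-! In a chart ball of radius `r` put `φ x = exp (x, X x)`. Since `exp (x, 0) = x` and `exp (x, s •
v)` runs along the geodesic with velocity `v`, the differential of `exp` at `(x, 0)` is `(u, w) ↦ u
+ w`. Hence `(Dφ - id) h = (D exp (x, X x) - D exp (x, 0)) (h, DX h) + DX h`. The bounds on `D² exp`
and on `DX` make each summand at most `ε/4 * ‖h‖`, so `φ` is an `ε/2`-Lipschitz perturbation of the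
identity: it is injective, it is a `C^k`-diffeomorphism onto an open set, and its image contains the
ball of radius `(1 - ε/2) * r` around `φ 0`. The bound on the first derivative of `exp` gives `‖φ 0‖
≤ ε * r / 2`. This is `IsRiemannianOn.expField_ball`.

Globally, injectivity on chart balls bounds the fibres. Local finiteness traps the preimage of a
compact set in finitely many compact chart balls, which gives properness. If the shrunken images
cover `M`, the map is a proper surjective local homeomorphism onto a connected space, hence a finite
covering; a point in a single chart domain forces one sheet.

Two foundations support this. Smoothness of `exp` on an open domain is smooth dependence of
solutions of differential equations on initial values: solutions are zeros of `(p, c) ↦ c - p - ∫ f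
∘ c` on a space of continuous paths, and the implicit function theorem applies because identity
minus a Volterra operator is invertible (`exists_contDiffAt_flow`). The exponential map of `M`
agrees with that of a chart because the geodesic equation is coordinate invariant
(`GeodesicEqAt.comp`) and geodesics in a Hausdorff manifold are unique (`IsGeodesicOn.eqOn_Ioo`). -/

noncomputable section

set_option maxSynthPendingDepth 3
set_option linter.unusedSectionVars false

/-! ### Superposition operators on spaces of continuous maps -/

section Superposition

variable {K : Type*} [TopologicalSpace K] [CompactSpace K]
  {F : Type v} [NormedAddCommGroup F] [NormedSpace ℝ F]
  {H : Type v} [NormedAddCommGroup H] [NormedSpace ℝ H]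

open Classical in
/-- The superposition operator `c ↦ f ∘ c` on continuous maps (zero if `f ∘ c` is discontinuous). -/
def superposition (f : F → H) (c : C(K, F)) : C(K, H) :=
  if h : Continuous (f ∘ c) then ⟨f ∘ c, h⟩ else 0

theorem superposition_apply {f : F → H} {Ω : Set F} (hf : ContinuousOn f Ω) {c : C(K, F)}
    (hc : ∀ t, c t ∈ Ω) (t : K) : superposition f c t = f (c t) := by
  have h : Continuous (f ∘ c) := hf.comp_continuous c.continuous hc
  simp [superposition, h]

/-- Pointwise evaluation of a continuous family of operators on a continuous map. -/
def pointwiseApply : C(K, F →L[ℝ] H) →L[ℝ] C(K, F) →L[ℝ] C(K, H) :=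
  LinearMap.mkContinuous₂
    (LinearMap.mk₂ ℝ (fun (A : C(K, F →L[ℝ] H)) (c : C(K, F)) =>
        (⟨fun t => A t (c t), by fun_prop⟩ : C(K, H)))
      (fun _ _ _ => by ext; simp) (fun _ _ _ => by ext; simp)
      (fun _ _ _ => by ext; simp) (fun _ _ _ => by ext; simp))
    1 (fun A c => by
      rw [one_mul, ContinuousMap.norm_le _ (by positivity)]
      intro t
      exact ((A t).le_opNorm _).trans
        (mul_le_mul (A.norm_coe_le_norm t) (c.norm_coe_le_norm t) (by positivity) (by positivity)))

@[simp]
theorem pointwiseApply_apply (A : C(K, F →L[ℝ] H)) (c : C(K, F)) (t : K) :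
    pointwiseApply A c t = A t (c t) := rfl

theorem isOpen_setOf_forall_mem {Ω : Set F} (hΩ : IsOpen Ω) :
    IsOpen {c : C(K, F) | ∀ t, c t ∈ Ω} := by
  simpa [MapsTo] using ContinuousMap.isOpen_setOfPred_mapsTo (isCompact_univ (X := K)) hΩ

/-- The mean value inequality is applied at each `t` on a ball around `c t`. Compactness of the
range of `c` makes the radius, and the closeness of `fderiv ℝ f` to its value at `c t`, uniform in
`t`. -/
theorem hasFDerivAt_superposition {f : F → H} {Ω : Set F} (hΩ : IsOpen Ω)
    (hf : ContDiffOn ℝ 1 f Ω) {c : C(K, F)} (hc : ∀ t, c t ∈ Ω) :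
    HasFDerivAt (superposition (K := K) f)
      (pointwiseApply (superposition (fderiv ℝ f) c)) c := by
  have hcont : ContinuousOn (fderiv ℝ f) Ω := hf.continuousOn_fderiv_of_isOpen hΩ le_rfl
  have hdiff : ∀ x ∈ Ω, HasFDerivAt f (fderiv ℝ f x) x := fun x hx =>
    ((hf.differentiableOn one_ne_zero).differentiableAt (hΩ.mem_nhds hx)).hasFDerivAt
  have hK : IsCompact (range c) := isCompact_range c.continuous
  have hKΩ : range c ⊆ Ω := by rintro _ ⟨t, rfl⟩; exact hc t
  rw [hasFDerivAt_iff_isLittleO, Asymptotics.isLittleO_iff]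
  intro e he
  have h1 := hK.uniformContinuousAt_of_continuousAt (fderiv ℝ f)
    (fun a ha => hcont.continuousAt (hΩ.mem_nhds (hKΩ ha))) (Metric.dist_mem_uniformity he)
  obtain ⟨d, hd, h1⟩ := Metric.mem_uniformity_dist.1 h1
  obtain ⟨d', hd', h2⟩ := hK.exists_thickening_subset_open hΩ hKΩ
  filter_upwards [Metric.ball_mem_nhds c (lt_min hd hd')] with b hb
  have hmem : ∀ t, ∀ z ∈ Metric.ball (c t) (min d d'), z ∈ Ω := fun t z hz =>
    h2 (Metric.mem_thickening_iff.2 ⟨c t, mem_range_self t, hz.trans_le (min_le_right _ _)⟩)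
  have hbt : ∀ t, b t ∈ Metric.ball (c t) (min d d') := fun t =>
    (ContinuousMap.dist_apply_le_dist t).trans_lt hb
  rw [ContinuousMap.norm_le _ (by positivity)]
  intro t
  have hbΩ : ∀ s, b s ∈ Ω := fun s => hmem s _ (hbt s)
  simp only [ContinuousMap.sub_apply, pointwiseApply_apply, superposition_apply hf.continuousOn hbΩ,
    superposition_apply hf.continuousOn hc, superposition_apply hcont hc]
  refine ((convex_ball (c t) (min d d')).norm_image_sub_le_of_norm_hasFDerivWithin_le'
    (C := e) (fun z hz => (hdiff z (hmem t z hz)).hasFDerivWithinAt) (fun z hz => ?_)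
    (Metric.mem_ball_self (lt_min hd hd')) (hbt t)).trans ?_
  · have := h1 (a := c t) (b := z)
      (by rw [dist_comm]; exact (Metric.mem_ball.1 hz).trans_le (min_le_left _ _)) (mem_range_self t)
    rw [mem_ofPred_eq, dist_comm, dist_eq_norm] at this
    exact this.le
  · gcongr
    exact (b - c).norm_coe_le_norm t

/-- The derivative is again a superposition operator, that of `fderiv ℝ f`, followed by a continuous
linear map. The induction therefore varies the target space, which must stay in one universe when
`H` is replaced by `F →L[ℝ] H`. -/
theorem contDiffOn_superposition {Ω : Set F} (hΩ : IsOpen Ω) (n : ℕ) {H : Type v}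
    [NormedAddCommGroup H] [NormedSpace ℝ H] {f : F → H} (hf : ContDiffOn ℝ ∞ f Ω) :
    ContDiffOn ℝ n (superposition (K := K) f) {c | ∀ t, c t ∈ Ω} := by
  have hO := isOpen_setOf_forall_mem (K := K) hΩ
  induction n generalizing H with
  | zero =>
    rw [Nat.cast_zero, contDiffOn_zero]
    exact fun c hc => (hasFDerivAt_superposition hΩ (hf.of_le (by simp)) hc).continuousAt.continuousWithinAt
  | succ n ih =>
    rw [Nat.cast_succ, contDiffOn_succ_iff_fderiv_of_isOpen hO]
    refine ⟨fun c hc => (hasFDerivAt_superposition hΩ (hf.of_le (by simp))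
      hc).differentiableAt.differentiableWithinAt, by simp, ?_⟩
    have h := (pointwiseApply (K := K) (F := F) (H := H)).contDiff.comp_contDiffOn
      (ih (hf.fderiv_of_isOpen hΩ (m := ∞) (by simp)))
    exact h.congr fun c hc => (hasFDerivAt_superposition hΩ (hf.of_le (by simp)) hc).fderiv

end Superposition

/-! ### Volterra operators -/

section Volterra

variable {F : Type v} [NormedAddCommGroup F] [NormedSpace ℝ F] [CompleteSpace F] {a b : ℝ}

/-- The operator `c ↦ ∫₀ᵗ c` on `C([a, b], F)`. -/
def volterra (hab : a ≤ b) (F : Type v) [NormedAddCommGroup F] [NormedSpace ℝ F] :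
    C(Icc a b, F) →L[ℝ] C(Icc a b, F) :=
  LinearMap.mkContinuous
    { toFun := fun c => ⟨fun t => ∫ s in (0:ℝ)..t, c (projIcc a b hab s),
        (intervalIntegral.continuous_primitive (fun _ _ =>
          (Continuous.intervalIntegrable (by fun_prop) _ _)) 0).comp continuous_subtype_val⟩
      map_add' := fun c d => by
        ext t
        simp only [ContinuousMap.add_apply, ContinuousMap.coe_mk]
        exact intervalIntegral.integral_add (Continuous.intervalIntegrable (by fun_prop) _ _)
          (Continuous.intervalIntegrable (by fun_prop) _ _)
      map_smul' := fun r c => by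
        ext t
        simp }
    (max |a| |b|) (fun c => by
      rw [ContinuousMap.norm_le _ (by positivity)]
      intro t
      refine (intervalIntegral.norm_integral_le_of_norm_le_const (C := ‖c‖)
        fun s _ => c.norm_coe_le_norm _).trans ?_
      rw [mul_comm, sub_zero]
      gcongr
      exact abs_le_max_abs_abs t.2.1 t.2.2)

/-- Keeping `|t| ^ n` in the bound, rather than its maximum, lets each integration contribute a
factor `1 / (n + 1)`, whence the factorial. -/
theorem norm_volterra_pow_apply_le (hab : a ≤ b) (h0 : (0:ℝ) ∈ Icc a b) (A : C(Icc a b, F →L[ℝ] F))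
    (n : ℕ) (c : C(Icc a b, F)) (t : Icc a b) :
    ‖(((volterra hab F).comp (pointwiseApply A)) ^ n) c t‖ ≤ (‖A‖ * |(t:ℝ)|) ^ n / n.factorial * ‖c‖ := by
  induction n generalizing t with
  | zero => simpa using c.norm_coe_le_norm t
  | succ n ih =>
    rw [pow_succ']
    set d := (((volterra hab F).comp (pointwiseApply A)) ^ n) c with hd
    change ‖∫ s in (0:ℝ)..t, A (projIcc a b hab s) (d (projIcc a b hab s))‖ ≤ _
    have key : ∀ s ∈ Set.uIcc 0 (t:ℝ), ‖A (projIcc a b hab s) (d (projIcc a b hab s))‖ ≤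
        ‖A‖ ^ (n+1) / n.factorial * ‖c‖ * |s| ^ n := by
      intro s hs
      have hs' : s ∈ Icc a b := (uIcc_subset_Icc h0 t.2) hs
      have h := ih ⟨s, hs'⟩
      rw [projIcc_of_mem hab hs']
      calc _ ≤ ‖A‖ * ((‖A‖ * |s|) ^ n / n.factorial * ‖c‖) :=
            ((A _).le_opNorm _).trans
              (mul_le_mul (A.norm_coe_le_norm _) h (by positivity) (by positivity))
        _ = _ := by ring
    have hint : |∫ s in (0:ℝ)..t, |s| ^ n| = |(t:ℝ)| ^ (n+1) / (n+1) := by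
      rcases le_total 0 (t:ℝ) with ht | ht
      · rw [intervalIntegral.integral_congr (g := fun s => s ^ n), integral_pow]
        · rw [abs_of_nonneg ht, abs_of_nonneg]
          · simp
          · simp; positivity
        · intro s hs
          rw [uIcc_of_le ht] at hs
          simp [abs_of_nonneg hs.1]
      · rw [intervalIntegral.integral_congr (g := fun s => (-s) ^ n),
          intervalIntegral.integral_comp_neg (fun s => s ^ n), integral_pow]
        · rw [abs_of_nonpos ht, neg_zero, abs_of_nonpos]
          · simp; ring
          · have : 0 ≤ (-(t:ℝ)) ^ (n+1) := pow_nonneg (by linarith) _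
            simp only [ne_eq, Nat.add_eq_zero_iff, one_ne_zero, and_false, not_false_eq_true, zero_pow, zero_sub]
            apply div_nonpos_of_nonpos_of_nonneg <;> [linarith; positivity]
        · intro s hs
          rw [uIcc_of_ge ht] at hs
          simp [abs_of_nonpos hs.2]
    refine (intervalIntegral.norm_integral_le_abs_of_norm_le (μ := MeasureTheory.volume)
      (g := fun s => ‖A‖ ^ (n+1) / n.factorial * ‖c‖ * |s| ^ n) ?_ ?_).trans ?_
    · exact MeasureTheory.ae_restrict_of_forall_mem measurableSet_uIoc fun s hs => key s (uIoc_subset_uIcc hs)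
    · exact Continuous.intervalIntegrable (by fun_prop) _ _
    · rw [intervalIntegral.integral_const_mul, abs_mul, hint, abs_of_nonneg (by positivity),
        Nat.factorial_succ]
      push_cast
      apply le_of_eq
      rw [mul_pow]
      field_simp

/-- No smallness of `A` is needed: some power `T ^ n` has norm below `1`, so `1 - T ^ n` is
invertible by a Neumann series, and `1 - T` is a factor of it that commutes with its cofactor, the
geometric sum. -/
theorem isUnit_one_sub_volterra (hab : a ≤ b) (h0 : (0:ℝ) ∈ Icc a b) (A : C(Icc a b, F →L[ℝ] F)) :
    IsUnit (1 - (volterra hab F).comp (pointwiseApply A)) := by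
  set T := (volterra hab F).comp (pointwiseApply A)
  set m := max |a| |b|
  obtain ⟨n, hn⟩ := (((FloorSemiring.tendsto_pow_div_factorial_atTop (‖A‖ * m)).eventually
    (gt_mem_nhds one_half_pos))).exists
  have hT : ‖T ^ n‖ < 1 := by
    refine (ContinuousLinearMap.opNorm_le_bound _ one_half_pos.le fun c => ?_).trans_lt one_half_lt_one
    rw [ContinuousMap.norm_le _ (by positivity)]
    intro t
    refine (norm_volterra_pow_apply_le hab h0 A n c t).trans ?_
    refine mul_le_mul_of_nonneg_right ?_ (norm_nonneg c)
    refine le_trans ?_ (show (‖A‖ * m) ^ n / n.factorial ≤ 1 / 2 from hn.le)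
    gcongr
    exact abs_le_max_abs_abs t.2.1 t.2.2
  have h1 : IsUnit (1 - T ^ n) := (Units.oneSub (T ^ n) hT).isUnit
  rw [← mul_neg_geom_sum] at h1
  have hcomm : Commute (1 - T) (∑ i ∈ Finset.range n, T ^ i) :=
    Commute.sum_right _ _ _ fun i _ => ((Commute.one_left T).sub_left (Commute.refl T)).pow_right i
  exact (hcomm.isUnit_mul_iff.1 h1).1

end Volterra

/-! ### Smooth dependence of solutions of ordinary differential equations on initial values -/

section Flow

variable {F : Type v} [NormedAddCommGroup F] [NormedSpace ℝ F]

/-- Constant maps as a continuous linear map. -/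
def constCLM (K : Type*) [TopologicalSpace K] [CompactSpace K] (F : Type v) [NormedAddCommGroup F]
    [NormedSpace ℝ F] : F →L[ℝ] C(K, F) :=
  LinearMap.mkContinuous
    { toFun := fun p => ContinuousMap.const K p
      map_add' := fun _ _ => rfl
      map_smul' := fun _ _ => rfl } 1 (fun p => by
      rw [one_mul, ContinuousMap.norm_le _ (by positivity)]
      exact fun _ => le_rfl)

/-- A solution on `[a, b]` of an autonomous smooth differential equation persists when the initial
value is perturbed, and depends smoothly on it. -/
theorem exists_contDiffAt_flow [CompleteSpace F] {f : F → F} {Ω : Set F} (hΩ : IsOpen Ω)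
    (hf : ContDiffOn ℝ ∞ f Ω) {a b : ℝ} (h0 : (0:ℝ) ∈ Ioo a b) {c : ℝ → F}
    (hcΩ : ∀ t ∈ Icc a b, c t ∈ Ω) (hc : ∀ t ∈ Icc a b, HasDerivAt c (f (c t)) t) :
    ∃ ψ : F → ℝ → F, (∀ t, ContDiffAt ℝ ∞ (fun p => ψ p t) (c 0)) ∧
      ∀ᶠ p in 𝓝 (c 0), ψ p 0 = p ∧
        ∀ t ∈ Ioo a b, ψ p t ∈ Ω ∧ HasDerivAt (ψ p) (f (ψ p t)) t := by
  have hab : a ≤ b := (h0.1.trans h0.2).le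
  have h0' : (0:ℝ) ∈ Icc a b := Ioo_subset_Icc_self h0
  have hcc : ContinuousOn c (Icc a b) := fun t ht => (hc t ht).continuousAt.continuousWithinAt
  let C₀ : C(Icc a b, F) := ⟨fun t => c t, hcc.domRestrict⟩
  have hC₀ : ∀ t, C₀ t ∈ Ω := fun t => hcΩ t t.2
  let S : C(Icc a b, F) → C(Icc a b, F) := superposition f
  let V := volterra hab F
  -- The zeros of `Φ` are the pairs (initial value, path) solving the integral equation. Its partial
  -- derivative in the path is identity minus a Volterra operator.
  let Φ : F × C(Icc a b, F) → C(Icc a b, F) := fun q => q.2 - constCLM _ F q.1 - V (S q.2)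
  have hO := isOpen_setOf_forall_mem (K := Icc a b) hΩ
  have hS : ContDiffAt ℝ ∞ S C₀ := by
    refine (contDiffOn_infty.2 fun n => contDiffOn_superposition hΩ n hf).contDiffAt (hO.mem_nhds hC₀)
  have hΦ : ContDiffAt ℝ ∞ Φ (c 0, C₀) :=
    (contDiffAt_snd.sub ((constCLM _ F).contDiff.contDiffAt.comp _ contDiffAt_fst)).sub
      (V.contDiff.contDiffAt.comp _ (ContDiffAt.comp (c 0, C₀) hS contDiffAt_snd))
  have hS' := hasFDerivAt_superposition (K := Icc a b) hΩ (hf.of_le (by simp)) hC₀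
  set A := superposition (fderiv ℝ f) C₀
  have hΦ' : fderiv ℝ Φ (c 0, C₀) ∘L .inr ℝ F C(Icc a b, F) = 1 - V.comp (pointwiseApply A) := by
    have h1 : HasFDerivAt Φ (ContinuousLinearMap.snd ℝ F C(Icc a b, F)
        - (constCLM _ F).comp (ContinuousLinearMap.fst ℝ F C(Icc a b, F))
        - V.comp ((pointwiseApply A).comp (ContinuousLinearMap.snd ℝ F C(Icc a b, F)))) (c 0, C₀) :=
      (hasFDerivAt_snd.sub ((constCLM _ F).hasFDerivAt.comp (c 0, C₀) hasFDerivAt_fst)).sub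
        (V.hasFDerivAt.comp (c 0, C₀) (HasFDerivAt.comp (g := S) (c 0, C₀) hS' hasFDerivAt_snd))
    rw [h1.fderiv]
    ext h t
    simp
  have hinv : (fderiv ℝ Φ (c 0, C₀) ∘L .inr ℝ F C(Icc a b, F)).IsInvertible := by
    rw [hΦ']
    obtain ⟨w, hw⟩ := isUnit_one_sub_volterra hab h0' A
    exact ⟨ContinuousLinearEquiv.unitsEquiv ℝ _ w, by ext1 x; rw [← hw]; rfl⟩
  have hΦ0 : Φ (c 0, C₀) = 0 := by
    ext t
    have ht : uIcc 0 (t:ℝ) ⊆ Icc a b := uIcc_subset_Icc h0' t.2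
    have h1 : ∫ s in (0:ℝ)..t, (S C₀) (projIcc a b hab s) = c t - c 0 := by
      rw [intervalIntegral.integral_congr (g := fun s => f (c s))]
      · exact intervalIntegral.integral_eq_sub_of_hasDerivAt (fun s hs => hc s (ht hs))
          ((hf.continuousOn.comp (hcc.mono ht) fun s hs => hcΩ s (ht hs)).intervalIntegrable)
      · intro s hs
        simp only [S, superposition_apply hf.continuousOn hC₀, projIcc_of_mem hab (ht hs)]
        rfl
    change c t - c 0 - ∫ s in (0:ℝ)..t, (S C₀) (projIcc a b hab s) = 0
    rw [h1, sub_self]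
  let χ := hΦ.implicitFunction (by simp) hinv
  have hχ : ContDiffAt ℝ ∞ χ (c 0) := hΦ.contDiffAt_implicitFunction (by simp) hinv
  have hχ0 : χ (c 0) = C₀ := hΦ.implicitFunction_apply_self (by simp) hinv
  -- Outside `[a, b]` the path is frozen at its endpoint values, so evaluation at any `t` is smooth
  -- in `p`; the differential equation is claimed on the open interval only.
  refine ⟨fun p t => χ p (projIcc a b hab t), fun t => ?_, ?_⟩
  · exact (ContinuousMap.evalCLM ℝ (projIcc a b hab t)).contDiff.contDiffAt.comp _ hχ
  · filter_upwards [hΦ.eventually_apply_implicitFunction (by simp) hinv,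
      hχ.continuousAt.eventually_mem (hO.mem_nhds (hχ0 ▸ hC₀))] with p hp hpΩ
    have hp' : Φ (p, χ p) = 0 := hp.trans hΦ0
    have heq : ∀ t : Icc a b, χ p t = p + ∫ s in (0:ℝ)..t, (S (χ p)) (projIcc a b hab s) := by
      intro t
      have := DFunLike.congr_fun hp' t
      change χ p t - p - ∫ s in (0:ℝ)..t, (S (χ p)) (projIcc a b hab s) = 0 at this
      rwa [sub_sub, sub_eq_zero] at this
    refine ⟨?_, fun t ht => ⟨hpΩ _, ?_⟩⟩
    · simpa [projIcc_of_mem hab h0'] using heq ⟨0, h0'⟩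
    · have h1 : HasDerivAt (fun t => p + ∫ s in (0:ℝ)..t, (S (χ p)) (projIcc a b hab s))
          ((S (χ p)) (projIcc a b hab t)) t :=
        ((Continuous.integral_hasStrictDerivAt (f := fun s => (S (χ p)) (projIcc a b hab s))
          (by fun_prop) 0 t).hasDerivAt).const_add p
      rw [superposition_apply hf.continuousOn hpΩ] at h1
      refine h1.congr_of_eventuallyEq ?_
      filter_upwards [Ioo_mem_nhds ht.1 ht.2] with s hs
      rw [heq, projIcc_of_mem hab (Ioo_subset_Icc_self hs)]

/-- Two curves on an open interval which agree locally around some point, and which agree locally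
around every limit of such points, agree. -/
theorem eqOn_Ioo_of_eventuallyEq {Y : Type*} {c₁ c₂ : ℝ → Y} {a b t₀ : ℝ} (ht₀ : t₀ ∈ Ioo a b)
    (h0 : c₁ =ᶠ[𝓝 t₀] c₂)
    (h : ∀ t ∈ Ioo a b, (∃ᶠ s in 𝓝 t, c₁ =ᶠ[𝓝 s] c₂) → c₁ =ᶠ[𝓝 t] c₂) : EqOn c₁ c₂ (Ioo a b) := by
  have hsub : Ioo a b ⊆ {t | c₁ =ᶠ[𝓝 t] c₂} := by
    refine isPreconnected_Ioo.subset_of_closure_inter_subset isOpen_setOfPred_eventually_nhds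
      ⟨t₀, ht₀, h0⟩ ?_
    rintro t ⟨ht, ht'⟩
    exact h t ht' (mem_closure_iff_frequently.1 ht)
  exact fun t ht => (hsub ht).self_of_nhds

/-- Local uniqueness of integral curves of a `C¹` vector field. -/
theorem eventuallyEq_of_hasDerivAt {f : F → F} {p : F} (hf : ContDiffAt ℝ 1 f p) {c₁ c₂ : ℝ → F} {t : ℝ}
    (h₁ : ∀ᶠ s in 𝓝 t, HasDerivAt c₁ (f (c₁ s)) s) (h₂ : ∀ᶠ s in 𝓝 t, HasDerivAt c₂ (f (c₂ s)) s)
    (hp : c₁ t = p) (heq : c₁ t = c₂ t) : c₁ =ᶠ[𝓝 t] c₂ := by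
  obtain ⟨K, s, hs, hK⟩ := hf.exists_lipschitzOnWith
  refine ODE_solution_unique_of_eventually (v := fun _ => f) (s := fun _ => s) (K := K)
    (Filter.Eventually.of_forall fun _ => hK)
    (h₁.and (h₁.self_of_nhds.continuousAt.eventually_mem (hp ▸ hs)))
    (h₂.and (h₂.self_of_nhds.continuousAt.eventually_mem (heq ▸ hp ▸ hs))) heq

/-- Uniqueness of integral curves of a `C¹` vector field on an open set. -/
theorem eqOn_Ioo_of_hasDerivAt {f : F → F} {Ω : Set F} (hΩ : IsOpen Ω) (hf : ContDiffOn ℝ 1 f Ω)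
    {c₁ c₂ : ℝ → F} {a b t₀ : ℝ} (ht₀ : t₀ ∈ Ioo a b) (hm : MapsTo c₁ (Ioo a b) Ω)
    (h₁ : ∀ s ∈ Ioo a b, HasDerivAt c₁ (f (c₁ s)) s)
    (h₂ : ∀ s ∈ Ioo a b, HasDerivAt c₂ (f (c₂ s)) s)
    (heq : c₁ t₀ = c₂ t₀) : EqOn c₁ c₂ (Ioo a b) := by
  have key : ∀ t ∈ Ioo a b, c₁ t = c₂ t → c₁ =ᶠ[𝓝 t] c₂ := fun t ht h => by
    have hn := isOpen_Ioo.mem_nhds ht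
    exact eventuallyEq_of_hasDerivAt (hf.contDiffAt (hΩ.mem_nhds (hm ht)))
      (Filter.eventually_of_mem hn h₁) (Filter.eventually_of_mem hn h₂) rfl h
  refine eqOn_Ioo_of_eventuallyEq ht₀ (key t₀ ht₀ heq) fun t ht hfr => key t ht ?_
  have h1 := (h₁ t ht).continuousAt
  have h2 := (h₂ t ht).continuousAt
  by_contra hne
  exact hfr ((h1.ne_iff_eventually_ne h2).1 hne |>.mono fun s hs h => hs h.self_of_nhds)

end Flow

/-! ### Geodesics on open subsets of a normed space -/

section LocalGeodesics

variable {E : Type v} [NormedAddCommGroup E] [NormedSpace ℝ E]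

/-- `G` is a smooth Riemannian metric on the open set `U`. -/
structure IsRiemannianOn (G : E → E →L[ℝ] E →L[ℝ] ℝ) (U : Set E) : Prop where
  isOpen : IsOpen U
  contDiffOn : ContDiffOn ℝ ∞ G U
  symm : ∀ x ∈ U, ∀ v w, G x v w = G x w v
  pos : ∀ x ∈ U, ∀ v, v ≠ 0 → 0 < G x v v

/-- The quadratic Christoffel symbol of the first kind, as a linear form. -/
def christoffelForm (G : E → E →L[ℝ] E →L[ℝ] ℝ) (x v : E) : E →L[ℝ] ℝ :=
  fderiv ℝ G x v v - (1 / 2 : ℝ) • ((fderiv ℝ G x).flip v).flip v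

theorem christoffelForm_apply (G : E → E →L[ℝ] E →L[ℝ] ℝ) (x v w : E) :
    christoffelForm G x v w = christoffelFirst G x v v w := by
  simp [christoffelForm, christoffelFirst]
  ring

/-- The second derivative of a geodesic through `x` with velocity `v`. -/
def spray (G : E → E →L[ℝ] E →L[ℝ] ℝ) (x v : E) : E :=
  -(G x).inverse (christoffelForm G x v)

/-- The vector field on the tangent bundle whose integral curves are the geodesics. -/
def geodesicField (G : E → E →L[ℝ] E →L[ℝ] ℝ) (p : E × E) : E × E :=
  (p.2, spray G p.1 p.2)

variable {G : E → E →L[ℝ] E →L[ℝ] ℝ} {U : Set E}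

/-- Positive definiteness gives injectivity; `E` and its dual have equal finite dimension. -/
theorem IsRiemannianOn.isInvertible [FiniteDimensional ℝ E] (hG : IsRiemannianOn G U) {x : E}
    (hx : x ∈ U) : (G x).IsInvertible := by
  have hinj : Function.Injective (G x : E →ₗ[ℝ] E →L[ℝ] ℝ) := by
    rw [← LinearMap.ker_eq_bot, LinearMap.ker_eq_bot']
    intro v hv
    by_contra hne
    have h := hG.pos x hx v hne
    rw [show G x v = 0 from hv] at h
    simp at h
  have hdim : Module.finrank ℝ E = Module.finrank ℝ (E →L[ℝ] ℝ) := by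
    rw [← (LinearMap.toContinuousLinearMap (𝕜 := ℝ) (E := E) (F' := ℝ)).finrank_eq]
    exact (Subspace.dual_finrank_eq (K := ℝ) (V := E)).symm
  exact ⟨(LinearEquiv.ofInjectiveOfFinrankEq (G x : E →ₗ[ℝ] E →L[ℝ] ℝ) hinj
    hdim).toContinuousLinearEquiv, by ext1 v; rfl⟩

theorem IsRiemannianOn.geodesicEqAt_iff [FiniteDimensional ℝ E] (hG : IsRiemannianOn G U)
    {γ : ℝ → E} {t : ℝ} (ht : γ t ∈ U) :
    GeodesicEqAt G γ t ↔ deriv (deriv γ) t = spray G (γ t) (deriv γ t) := by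
  obtain ⟨e, he⟩ := hG.isInvertible ht
  have h1 : GeodesicEqAt G γ t ↔
      G (γ t) (deriv (deriv γ) t) = -christoffelForm G (γ t) (deriv γ t) := by
    rw [ContinuousLinearMap.ext_iff]
    refine forall_congr' fun w => ?_
    rw [← christoffelForm_apply, add_eq_zero_iff_eq_neg]
    rfl
  rw [h1, spray, ← he, ContinuousLinearMap.inverse_equiv]
  simp only [ContinuousLinearEquiv.coe_coe]
  rw [← map_neg, ← ContinuousLinearEquiv.eq_symm_apply]

/-- Inversion is smooth at invertible operators. The Christoffel form may be tested on fixed vectors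
because `E` is finite-dimensional. -/
theorem IsRiemannianOn.contDiffOn_spray [FiniteDimensional ℝ E] (hG : IsRiemannianOn G U) :
    ContDiffOn ℝ ∞ (fun p : E × E => spray G p.1 p.2) (U ×ˢ univ) := by
  have hmaps : MapsTo (Prod.fst : E × E → E) (U ×ˢ univ) U := fun p hp => hp.1
  have hfst : ContDiffOn ℝ ∞ (Prod.fst : E × E → E) (U ×ˢ univ) := contDiffOn_fst
  have hsnd : ContDiffOn ℝ ∞ (Prod.snd : E × E → E) (U ×ˢ univ) := contDiffOn_snd
  have hD : ContDiffOn ℝ ∞ (fun p : E × E => fderiv ℝ G p.1) (U ×ˢ univ) :=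
    (hG.contDiffOn.fderiv_of_isOpen hG.isOpen (m := ∞) (by simp)).comp hfst hmaps
  have hinv : ContDiffOn ℝ ∞ (fun p : E × E => (G p.1).inverse) (U ×ˢ univ) := fun p hp =>
    ((hG.isInvertible hp.1).contDiffAt_map_inverse).comp_contDiffWithinAt (f := fun q => G q.1) p
      ((hG.contDiffOn.comp hfst hmaps) p hp)
  have hΓ : ContDiffOn ℝ ∞ (fun p : E × E => christoffelForm G p.1 p.2) (U ×ˢ univ) := by
    rw [contDiffOn_clm_apply]
    intro w
    simp only [christoffelForm, sub_apply, smul_apply,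
      ContinuousLinearMap.flip_apply]
    exact (((hD.clm_apply hsnd).clm_apply hsnd).clm_apply contDiffOn_const).sub
      ((((hD.clm_apply contDiffOn_const).clm_apply hsnd).clm_apply hsnd).const_smul _)
  exact (hinv.clm_apply hΓ).neg

theorem IsRiemannianOn.contDiffOn_geodesicField [FiniteDimensional ℝ E] (hG : IsRiemannianOn G U) :
    ContDiffOn ℝ ∞ (geodesicField G) (U ×ˢ univ) :=
  contDiffOn_snd.prodMk hG.contDiffOn_spray

theorem IsRiemannianOn.hasDerivAt_of_geodesicEqAt [FiniteDimensional ℝ E] (hG : IsRiemannianOn G U)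
    {γ : ℝ → E} {t : ℝ} (hγ : ContDiffAt ℝ 2 γ t) (ht : γ t ∈ U) (h : GeodesicEqAt G γ t) :
    HasDerivAt (fun s => (γ s, deriv γ s)) (geodesicField G (γ t, deriv γ t)) t := by
  have h1 : HasDerivAt γ (deriv γ t) t := (hγ.differentiableAt (by simp)).hasDerivAt
  have h2 : HasDerivAt (deriv γ) (deriv (deriv γ) t) t :=
    ((hγ.derivWithin (m := 1) (by norm_num)).differentiableAt (by simp)).hasDerivAt
  rw [(hG.geodesicEqAt_iff ht).1 h] at h2
  exact h1.prodMk h2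

theorem IsRiemannianOn.geodesic_of_hasDerivAt [FiniteDimensional ℝ E] (hG : IsRiemannianOn G U)
    {c : ℝ → E × E} {J : Set ℝ} (hJ : IsOpen J) (hm : ∀ t ∈ J, (c t).1 ∈ U)
    (h : ∀ t ∈ J, HasDerivAt c (geodesicField G (c t)) t) :
    (∀ t ∈ J, deriv (fun s => (c s).1) t = (c t).2) ∧ ContDiffOn ℝ 2 (fun s => (c s).1) J ∧
      ∀ t ∈ J, GeodesicEqAt G (fun s => (c s).1) t := by
  have h1 : ∀ t ∈ J, HasDerivAt (fun s => (c s).1) (c t).2 t := fun t ht => (h t ht).fst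
  have h2 : ∀ t ∈ J, HasDerivAt (fun s => (c s).2) (spray G (c t).1 (c t).2) t :=
    fun t ht => (h t ht).snd
  have hd : ∀ t ∈ J, deriv (fun s => (c s).1) t = (c t).2 := fun t ht => (h1 t ht).deriv
  have hcc : ContinuousOn c J := fun t ht => (h t ht).continuousAt.continuousWithinAt
  have hsc : ContinuousOn (fun t => spray G (c t).1 (c t).2) J :=
    hG.contDiffOn_spray.continuousOn.comp hcc fun t ht => ⟨hm t ht, mem_univ _⟩
  refine ⟨hd, ?_, fun t ht => ?_⟩
  · rw [show (2 : WithTop ℕ∞) = 1 + 1 by norm_num, contDiffOn_succ_iff_deriv_of_isOpen hJ]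
    refine ⟨fun t ht => (h1 t ht).differentiableAt.differentiableWithinAt, by simp, ?_⟩
    refine ContDiffOn.congr ?_ hd
    rw [show (1 : WithTop ℕ∞) = 0 + 1 by norm_num, contDiffOn_succ_iff_deriv_of_isOpen hJ]
    refine ⟨fun t ht => (h2 t ht).differentiableAt.differentiableWithinAt, by simp, ?_⟩
    rw [contDiffOn_zero]
    exact hsc.congr fun t ht => (h2 t ht).deriv
  · rw [hG.geodesicEqAt_iff (hm t ht), hd t ht]
    have : deriv (fun s => (c s).1) =ᶠ[𝓝 t] fun s => (c s).2 :=
      Filter.eventually_of_mem (hJ.mem_nhds ht) hd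
    rw [this.deriv_eq, (h2 t ht).deriv]

theorem IsRiemannianOn.eventuallyEq_geodesic [FiniteDimensional ℝ E] (hG : IsRiemannianOn G U)
    {γ₁ γ₂ : ℝ → E} {t : ℝ} (h₁ : ∀ᶠ s in 𝓝 t, ContDiffAt ℝ 2 γ₁ s ∧ GeodesicEqAt G γ₁ s)
    (h₂ : ∀ᶠ s in 𝓝 t, ContDiffAt ℝ 2 γ₂ s ∧ GeodesicEqAt G γ₂ s) (ht : γ₁ t ∈ U)
    (heq : γ₁ t = γ₂ t) (heq' : deriv γ₁ t = deriv γ₂ t) : γ₁ =ᶠ[𝓝 t] γ₂ := by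
  have key : ∀ γ : ℝ → E, γ t ∈ U → (∀ᶠ s in 𝓝 t, ContDiffAt ℝ 2 γ s ∧ GeodesicEqAt G γ s) →
      ∀ᶠ s in 𝓝 t, HasDerivAt (fun s => (γ s, deriv γ s)) (geodesicField G (γ s, deriv γ s)) s := by
    intro γ hγ h
    filter_upwards [h, h.self_of_nhds.1.continuousAt.eventually_mem (hG.isOpen.mem_nhds hγ)] with s hs hsU
    exact hG.hasDerivAt_of_geodesicEqAt hs.1 hsU hs.2
  have := eventuallyEq_of_hasDerivAt (f := geodesicField G) (p := (γ₁ t, deriv γ₁ t))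
    ((hG.contDiffOn_geodesicField.of_le (by simp)).contDiffAt
      ((hG.isOpen.prod isOpen_univ).mem_nhds ⟨ht, mem_univ _⟩))
    (key γ₁ ht h₁) (key γ₂ (heq ▸ ht) h₂) rfl (by rw [heq, heq'])
  exact this.mono fun s hs => congrArg Prod.fst hs

theorem IsRiemannianOn.eqOn_geodesic [FiniteDimensional ℝ E] (hG : IsRiemannianOn G U)
    {p : E × E} {γ₁ γ₂ : ℝ → E} (h₁ : IsGeodesicFromIn G U p γ₁) (h₂ : IsGeodesicFromIn G U p γ₂) :
    EqOn γ₁ γ₂ (Icc 0 1) := by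
  obtain ⟨a₁, b₁, d₁, hd₁, hm₁, hc₁, hg₁⟩ := h₁
  obtain ⟨a₂, b₂, d₂, hd₂, hm₂, hc₂, hg₂⟩ := h₂
  have hd : 0 < min d₁ d₂ := lt_min hd₁ hd₂
  have key : ∀ (γ : ℝ → E) (d : ℝ), min d₁ d₂ ≤ d → MapsTo γ (Ioo (-d) (1 + d)) U →
      ContDiffOn ℝ 2 γ (Ioo (-d) (1 + d)) → (∀ t ∈ Ioo (-d) (1 + d), GeodesicEqAt G γ t) →
      ∀ s ∈ Ioo (-min d₁ d₂) (1 + min d₁ d₂),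
        HasDerivAt (fun s => (γ s, deriv γ s)) (geodesicField G (γ s, deriv γ s)) s := by
    intro γ d hdd hm hc hg s hs
    have hs' : s ∈ Ioo (-d) (1 + d) := ⟨by linarith [hs.1], by linarith [hs.2]⟩
    exact hG.hasDerivAt_of_geodesicEqAt (hc.contDiffAt (isOpen_Ioo.mem_nhds hs')) (hm hs') (hg s hs')
  have h := eqOn_Ioo_of_hasDerivAt (hG.isOpen.prod isOpen_univ)
    (hG.contDiffOn_geodesicField.of_le (by simp))
    (t₀ := 0) (a := -min d₁ d₂) (b := 1 + min d₁ d₂) ⟨by linarith, by linarith⟩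
    (fun s hs => ⟨hm₁ ⟨by linarith [hs.1, min_le_left d₁ d₂], by linarith [hs.2, min_le_left d₁ d₂]⟩,
      mem_univ _⟩)
    (key γ₁ d₁ (min_le_left _ _) hm₁ hc₁ hg₁) (key γ₂ d₂ (min_le_right _ _) hm₂ hc₂ hg₂)
    (by rw [a₁, a₂, b₁, b₂])
  exact fun t ht => congrArg Prod.fst (h ⟨by linarith [ht.1], by linarith [ht.2]⟩)

/-- The definition of `expIn` chooses an arbitrary geodesic; uniqueness makes every geodesic with
the given initial data compute it. -/
theorem IsRiemannianOn.expIn_eq [FiniteDimensional ℝ E] (hG : IsRiemannianOn G U)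
    {p : E × E} {γ : ℝ → E} (h : IsGeodesicFromIn G U p γ) : expIn G U p = γ 1 := by
  have hex : ∃ γ : ℝ → E, IsGeodesicFromIn G U p γ := ⟨γ, h⟩
  rw [expIn, dif_pos hex]
  exact hG.eqOn_geodesic hex.choose_spec h ⟨zero_le_one, le_rfl⟩

/-- The domain is open and `expIn` is smooth on it: a geodesic defined slightly beyond `[0, 1]`
persists under perturbation of its initial data, and its value at time `1` depends smoothly on them.
-/
theorem IsRiemannianOn.expDomainIn_mem_nhds [FiniteDimensional ℝ E] (hG : IsRiemannianOn G U)
    {p : E × E} (hp : p ∈ expDomainIn G U) :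
    expDomainIn G U ∈ 𝓝 p ∧ ContDiffAt ℝ ∞ (expIn G U) p := by
  obtain ⟨γ, h0, h0', d, hd, hm, hc, hg⟩ := hp
  -- Halving the margin gives a compact time interval that still contains `[0, 1]` in its interior.
  have hsub : Icc (-(d / 2)) (1 + d / 2) ⊆ Ioo (-d) (1 + d) := fun t ht =>
    ⟨by linarith [ht.1], by linarith [ht.2]⟩
  obtain ⟨ψ, hψ, hψ'⟩ := exists_contDiffAt_flow (hG.isOpen.prod isOpen_univ)
    hG.contDiffOn_geodesicField (a := -(d / 2)) (b := 1 + d / 2)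
    (c := fun t => (γ t, deriv γ t)) ⟨by linarith, by linarith⟩
    (fun t ht => ⟨hm (hsub ht), mem_univ _⟩)
    (fun t ht => hG.hasDerivAt_of_geodesicEqAt (hc.contDiffAt (isOpen_Ioo.mem_nhds (hsub ht)))
      (hm (hsub ht)) (hg t (hsub ht)))
  have hp : (γ 0, deriv γ 0) = p := by rw [h0, h0']
  simp only [hp] at hψ hψ'
  have hgeo : ∀ᶠ q in 𝓝 p, IsGeodesicFromIn G U q (fun t => (ψ q t).1) := by
    filter_upwards [hψ'] with q ⟨hq0, hq⟩
    obtain ⟨hq1, hq2, hq3⟩ := hG.geodesic_of_hasDerivAt (c := ψ q) isOpen_Ioo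
      (fun t ht => (hq t ht).1.1) (fun t ht => (hq t ht).2)
    refine ⟨congrArg Prod.fst hq0, ?_, d / 2, by linarith, fun t ht => (hq t ht).1.1, hq2, hq3⟩
    rw [hq1 0 ⟨by linarith, by linarith⟩, hq0]
  refine ⟨hgeo.mono fun q hq => ⟨_, hq⟩, ?_⟩
  exact (contDiffAt_fst.comp p (hψ 1)).congr_of_eventuallyEq (hgeo.mono fun q hq => hG.expIn_eq hq)

/-- The geodesic equation is homogeneous of degree two in time derivatives, and multiplication by
`s` in `[0, 1]` maps the time interval into itself. -/
theorem IsGeodesicFromIn.rescale {x v : E} {γ : ℝ → E} (h : IsGeodesicFromIn G U (x, v) γ)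
    {s : ℝ} (hs : s ∈ Icc (0:ℝ) 1) : IsGeodesicFromIn G U (x, s • v) (fun t => γ (s * t)) := by
  obtain ⟨h0, h0', d, hd, hm, hc, hg⟩ := h
  have hmaps : MapsTo (fun t => s * t) (Ioo (-d) (1 + d)) (Ioo (-d) (1 + d)) := fun t ht => by
    obtain ⟨h1, h2⟩ := ht
    obtain ⟨hs0, hs1⟩ := hs
    change -d < s * t ∧ s * t < 1 + d
    rcases le_total 0 t with h | h <;> constructor <;> nlinarith
  have hder : deriv (fun t => γ (s * t)) = fun t => s • deriv γ (s * t) :=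
    funext fun t => deriv_comp_mul_left s γ t
  refine ⟨by simpa using h0, ?_, d, hd, hm.comp hmaps,
    hc.comp (contDiffOn_const.mul contDiffOn_id) hmaps, fun t ht w => ?_⟩
  · rw [hder]
    simpa using congrArg (s • ·) h0'
  · have hder2 : deriv (deriv (fun t => γ (s * t))) t = s • s • deriv (deriv γ) (s * t) := by
      rw [hder, deriv_fun_const_smul_field, deriv_comp_mul_left s (deriv γ) t]
    have := hg (s * t) (hmaps ht) w
    rw [hder2, hder]
    have h2 : christoffelFirst G (γ (s * t)) (s • deriv γ (s * t)) (s • deriv γ (s * t)) w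
        = s * s * christoffelFirst G (γ (s * t)) (deriv γ (s * t)) (deriv γ (s * t)) w := by
      simp [christoffelFirst]
      ring
    rw [h2, map_smul, map_smul]
    simp only [smul_apply, smul_eq_mul]
    linear_combination s * s * this

theorem IsRiemannianOn.expIn_smul [FiniteDimensional ℝ E] (hG : IsRiemannianOn G U)
    {x v : E} {γ : ℝ → E} (h : IsGeodesicFromIn G U (x, v) γ) {s : ℝ} (hs : s ∈ Icc (0:ℝ) 1) :
    expIn G U (x, s • v) = γ s := by
  simpa using hG.expIn_eq (h.rescale hs)

theorem IsRiemannianOn.expIn_zero [FiniteDimensional ℝ E] (hG : IsRiemannianOn G U)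
    {x : E} (h : (x, (0:E)) ∈ expDomainIn G U) : expIn G U (x, 0) = x := by
  obtain ⟨γ, hγ⟩ := h
  simpa [hγ.1] using hG.expIn_smul hγ (s := 0) ⟨le_rfl, zero_le_one⟩

theorem IsRiemannianOn.fderiv_expIn_zero [FiniteDimensional ℝ E] (hG : IsRiemannianOn G U)
    {x : E} (h : (x, (0:E)) ∈ expDomainIn G U) (u w : E) :
    fderiv ℝ (expIn G U) (x, 0) (u, w) = u + w := by
  obtain ⟨hD, hsm⟩ := hG.expDomainIn_mem_nhds h
  have hdiff : HasFDerivAt (expIn G U) (fderiv ℝ (expIn G U) (x, 0)) (x, 0) :=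
    (hsm.differentiableAt (by simp)).hasFDerivAt
  have h1 : ∀ u, fderiv ℝ (expIn G U) (x, 0) (u, 0) = u := by
    intro u
    have ha : HasFDerivAt (fun y : E => expIn G U (y, 0))
        ((fderiv ℝ (expIn G U) (x, 0)).comp (ContinuousLinearMap.inl ℝ E E)) x :=
      HasFDerivAt.comp (g := expIn G U) x hdiff (hasFDerivAt_prodMk_left x (0:E))
    have hb : HasFDerivAt (fun y : E => expIn G U (y, 0)) (ContinuousLinearMap.id ℝ E) x := by
      refine (hasFDerivAt_id x).congr_of_eventuallyEq ?_
      have hc : Filter.Tendsto (fun y : E => (y, (0:E))) (𝓝 x) (𝓝 (x, 0)) :=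
        (by fun_prop : Continuous fun y : E => (y, (0:E))).tendsto x
      exact (hc.eventually_mem hD).mono fun y hy => hG.expIn_zero hy
    simpa using DFunLike.congr_fun (ha.unique hb) u
  -- Along the ray, `expIn` follows the geodesic for `s` in `[0, 1]` only, so one-sided derivatives
  -- at `0` are compared.
  have h2 : ∀ w, (x, w) ∈ expDomainIn G U → fderiv ℝ (expIn G U) (x, 0) (0, w) = w := by
    rintro w ⟨γ, hγ⟩
    have ha : HasDerivWithinAt (fun s : ℝ => expIn G U (x, s • w))
        (fderiv ℝ (expIn G U) (x, 0) (0, w)) (Icc 0 1) 0 := by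
      have : HasDerivAt (fun s : ℝ => (x, s • w)) (0, w) 0 := by
        simpa using (hasDerivAt_const (0:ℝ) x).prodMk ((hasDerivAt_id (0:ℝ)).smul_const w)
      have h3 : HasFDerivAt (expIn G U) (fderiv ℝ (expIn G U) (x, 0)) (x, (0:ℝ) • w) := by
        rwa [zero_smul]
      exact (h3.comp_hasDerivAt (0:ℝ) this).hasDerivWithinAt
    have hb : HasDerivWithinAt (fun s : ℝ => expIn G U (x, s • w)) w (Icc 0 1) 0 := by
      obtain ⟨-, h0', d, hd, -, hc, -⟩ := id hγ
      have h4 : HasDerivAt γ w 0 := by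
        rw [← show deriv γ 0 = w from h0']
        exact ((hc.contDiffAt (Ioo_mem_nhds (by linarith) (by linarith))).differentiableAt
          (by simp)).hasDerivAt
      refine h4.hasDerivWithinAt.congr (fun s hs => hG.expIn_smul hγ hs)
        (hG.expIn_smul hγ ⟨le_rfl, zero_le_one⟩)
    exact (uniqueDiffOn_Icc_zero_one 0 ⟨le_rfl, zero_le_one⟩).eq_deriv _ ha hb
  -- An arbitrary `w` enters the domain after scaling by a small positive `s`; linearity removes the
  -- factor.
  have h3 : fderiv ℝ (expIn G U) (x, 0) (0, w) = w := by
    have hc : Filter.Tendsto (fun s : ℝ => (x, s • w)) (𝓝[>] 0) (𝓝 (x, 0)) := by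
      have : Continuous fun s : ℝ => (x, s • w) := by fun_prop
      simpa using (this.tendsto 0).mono_left nhdsWithin_le_nhds
    obtain ⟨s, hs, hs0⟩ := ((hc.eventually_mem hD).and self_mem_nhdsWithin).exists
    have h4 := h2 (s • w) hs
    have h5 : ((0:E), s • w) = s • ((0:E), w) := by simp
    rw [h5, map_smul] at h4
    exact smul_right_injective E (ne_of_gt hs0) h4
  have h4 : (u, w) = (u, (0:E)) + ((0:E), w) := by simp
  rw [h4, map_add, h1, h3]

end LocalGeodesics

/-! ### Estimates for `exp ∘ X` on a ball -/

section Estimates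

variable {E : Type v} [NormedAddCommGroup E] [NormedSpace ℝ E]

theorem enorm_iteratedFDeriv_le_supNormDeriv {F F' : Type*} [NormedAddCommGroup F] [NormedSpace ℝ F]
    [NormedAddCommGroup F'] [NormedSpace ℝ F'] (φ : F → F') {S : Set F} (l : ℕ) {x : F}
    (hx : x ∈ S) : ‖iteratedFDeriv ℝ l φ x‖ₑ ≤ supNormDeriv φ S l :=
  le_iSup₂ (f := fun x (_ : x ∈ S) => ‖iteratedFDeriv ℝ l φ x‖ₑ) x hx

theorem norm_iteratedFDeriv_le_of_supNormDeriv_le {F F' : Type*} [NormedAddCommGroup F]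
    [NormedSpace ℝ F] [NormedAddCommGroup F'] [NormedSpace ℝ F'] {φ : F → F'} {S : Set F} {l : ℕ}
    {C : ℝ} (hC : 0 ≤ C) (h : supNormDeriv φ S l ≤ ENNReal.ofReal C) {x : F}
    (hx : x ∈ S) : ‖iteratedFDeriv ℝ l φ x‖ ≤ C := by
  have := (enorm_iteratedFDeriv_le_supNormDeriv φ l hx).trans h
  rwa [← ofReal_norm, ENNReal.ofReal_le_ofReal_iff hC] at this

theorem norm_fderiv_fderiv_eq {F F' : Type*} [NormedAddCommGroup F]
    [NormedSpace ℝ F] [NormedAddCommGroup F'] [NormedSpace ℝ F'] (φ : F → F') (x : F) :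
    ‖fderiv ℝ (fderiv ℝ φ) x‖ = ‖iteratedFDeriv ℝ 2 φ x‖ := by
  rw [← norm_iteratedFDeriv_fderiv, norm_iteratedFDeriv_one]

/-- A `C^k` map on a ball whose differential is close to the identity is a `C^k`-diffeomorphism
onto an open set that contains a slightly smaller ball. -/
theorem exists_partialDiffeomorph_ball [CompleteSpace E] [Nontrivial E] {φ : E → E} {r c : ℝ}
    (hc : 0 < c) (hc1 : c < 1) {k : ℕ∞} (hk : 1 ≤ k) (hφ : ContDiffOn ℝ k φ (Metric.ball 0 r))
    (hφ' : ∀ x ∈ Metric.ball (0:E) r, ‖fderiv ℝ φ x - ContinuousLinearMap.id ℝ E‖ ≤ c) :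
    (∃ Φ : PartialDiffeomorph 𝓘(ℝ, E) 𝓘(ℝ, E) E E k,
        Φ.source = Metric.ball 0 r ∧ EqOn φ Φ (Metric.ball 0 r)) ∧
      Metric.ball (φ 0) ((1 - c) * r) ⊆ φ '' Metric.ball 0 r := by
  have hk0 : (k : WithTop ℕ∞) ≠ 0 := by
    have : k ≠ 0 := (zero_lt_one.trans_le hk).ne'
    exact_mod_cast this
  have hd : ∀ x ∈ Metric.ball (0:E) r, HasFDerivAt φ (fderiv ℝ φ x) x := fun x hx =>
    ((hφ.differentiableOn hk0).differentiableAt (Metric.isOpen_ball.mem_nhds hx)).hasFDerivAt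
  let c' : NNReal := ⟨c, hc.le⟩
  have happ : ApproximatesLinearOn φ ((ContinuousLinearEquiv.refl ℝ E : E ≃L[ℝ] E) : E →L[ℝ] E)
      (Metric.ball 0 r) c' := by
    intro x hx y hy
    exact (convex_ball (0:E) r).norm_image_sub_le_of_norm_hasFDerivWithin_le'
      (fun z hz => (hd z hz).hasFDerivWithinAt) hφ' hy hx
  have hN : ‖(((ContinuousLinearEquiv.refl ℝ E).symm : E ≃L[ℝ] E) : E →L[ℝ] E)‖₊ = 1 := by
    exact NNReal.eq (ContinuousLinearMap.norm_id (𝕜 := ℝ) (E := E))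
  have hcN : Subsingleton E ∨
      c' < ‖(((ContinuousLinearEquiv.refl ℝ E).symm : E ≃L[ℝ] E) : E →L[ℝ] E)‖₊⁻¹ := by
    right
    rw [hN, inv_one]
    exact hc1
  let e := happ.toOpenPartialHomeomorph φ (Metric.ball 0 r) hcN Metric.isOpen_ball
  have heφ : ∀ x, e x = φ x := fun _ => rfl
  have hsymm : ContDiffOn ℝ k e.symm e.target := by
    intro y hy
    have hx := e.map_target hy
    have hx' : e.symm y ∈ Metric.ball (0:E) r := hx
    -- The differential is within `c < 1` of the identity, hence invertible by a Neumann series; the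
    -- inverse function theorem then makes the inverse `C^k`.
    have hu : IsUnit (fderiv ℝ φ (e.symm y)) := by
      have := (Units.oneSub (-(fderiv ℝ φ (e.symm y) - ContinuousLinearMap.id ℝ E))
        (by rw [norm_neg]; exact (hφ' _ hx').trans_lt hc1)).isUnit
      have h2 : (1 : E →L[ℝ] E) - -(fderiv ℝ φ (e.symm y) - ContinuousLinearMap.id ℝ E) =
          fderiv ℝ φ (e.symm y) := by
        rw [show (1 : E →L[ℝ] E) = ContinuousLinearMap.id ℝ E from rfl]
        abel
      rwa [Units.val_oneSub, h2] at this
    obtain ⟨w, hw⟩ := hu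
    refine (e.contDiffAt_symm (f₀' := ContinuousLinearEquiv.unitsEquiv ℝ E w) hy ?_ ?_).contDiffWithinAt
    · have h3 : ((ContinuousLinearEquiv.unitsEquiv ℝ E w : E ≃L[ℝ] E) : E →L[ℝ] E) =
        fderiv ℝ φ (e.symm y) := by rw [← hw]; rfl
      rw [h3]
      exact hd _ hx'
    · exact hφ.contDiffAt (Metric.isOpen_ball.mem_nhds hx')
  refine ⟨⟨⟨e.toPartialEquiv, e.open_source, e.open_target, ?_, ?_⟩, rfl, fun _ _ => rfl⟩, ?_⟩
  · exact contMDiffOn_iff_contDiffOn.2 hφ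
  · exact contMDiffOn_iff_contDiffOn.2 hsymm
  · intro y hy
    have h1c : 0 < 1 - c := by linarith
    -- A closed ball of radius `ρ` around `0` covers the closed ball of radius `(1 - c) * ρ` around
    -- `φ 0`; this is the `ρ` for which `y` lies on the boundary of the latter.
    have hy' : ‖y - φ 0‖ / (1 - c) < r := by
      rw [div_lt_iff₀ h1c, mul_comm]
      exact mem_ball_iff_norm.1 hy
    have hsub := happ.surjOn_closedBall_of_nonlinearRightInverse
      (ContinuousLinearEquiv.refl ℝ E).toNonlinearRightInverse (b := 0)
      (ε := ‖y - φ 0‖ / (1 - c)) (by positivity)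
      (Metric.closedBall_subset_ball hy')
    have hN' : ((ContinuousLinearEquiv.refl ℝ E).toNonlinearRightInverse.nnnorm : ℝ) = 1 := by
      exact congrArg NNReal.toReal hN
    rw [hN', inv_one] at hsub
    obtain ⟨x, hx, hxy⟩ := hsub (show y ∈ _ by
      rw [mem_closedBall_iff_norm]
      change _ ≤ (1 - c) * _
      rw [mul_div_cancel₀ _ h1c.ne'])
    exact ⟨x, Metric.closedBall_subset_ball hy' hx, hxy⟩

/-- The central estimate: `exp ∘ X` differs from the identity by a map with differential at most `ε
/ 2`, and moves the center by at most `ε * r / 2`. -/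
theorem IsRiemannianOn.expField_ball [FiniteDimensional ℝ E] [Nontrivial E]
    {G : E → E →L[ℝ] E →L[ℝ] ℝ} {U : Set E} (hG : IsRiemannianOn G U)
    {r ν ε : ℝ} (hr : 0 < r) (hν : 0 < ν)
    (hν' : ENNReal.ofReal ν < expRadius G (Metric.ball 0 r) U) (hε : 0 < ε) (hε' : ε < 1 / 2)
    {k : ℕ∞} (hk : 1 ≤ k) {X : E → E} (hX : ContDiffOn ℝ k X (Metric.ball 0 r))
    (hX0 : supNormDeriv X (Metric.ball 0 r) 0 <
      min (ENNReal.ofReal (ε * r) / (2 * expBoundFst G (Metric.ball 0 r) U ν))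
        (min (ENNReal.ofReal ν)
          (ENNReal.ofReal ε / (4 * (expBoundSnd G (Metric.ball 0 r) U ν + 1)))))
    (hX1 : supNormDeriv X (Metric.ball 0 r) 1 < ENNReal.ofReal (ε / 4)) :
    (∀ x ∈ Metric.ball 0 r, (x, X x) ∈ expDomainIn G U) ∧
      (∃ Φ : PartialDiffeomorph 𝓘(ℝ, E) 𝓘(ℝ, E) E E k,
        Φ.source = Metric.ball 0 r ∧
          EqOn (fun x => expIn G U (x, X x)) Φ (Metric.ball 0 r)) ∧
      Metric.ball 0 (r * (1 - 2 * ε)) ⊆ (fun x => expIn G U (x, X x)) '' Metric.ball 0 r := by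
  have hk0 : (k : WithTop ℕ∞) ≠ 0 := by
    have : k ≠ 0 := (zero_lt_one.trans_le hk).ne'
    exact_mod_cast this
  obtain ⟨h1, h23⟩ := lt_min_iff.1 hX0
  obtain ⟨h2, h3⟩ := lt_min_iff.1 h23
  have hXν : ∀ x ∈ Metric.ball (0:E) r, ‖X x‖ ≤ ν := fun x hx => by
    rw [← norm_iteratedFDeriv_zero (𝕜 := ℝ) (f := X)]
    exact norm_iteratedFDeriv_le_of_supNormDeriv_le hν.le h2.le hx
  have hXd : ∀ x ∈ Metric.ball (0:E) r, ‖fderiv ℝ X x‖ ≤ ε / 4 := fun x hx => by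
    rw [← norm_iteratedFDeriv_one]
    exact norm_iteratedFDeriv_le_of_supNormDeriv_le (by positivity) hX1.le hx
  have hDom : ∀ x ∈ Metric.closedBall (0:E) r, ∀ v ∈ Metric.closedBall (0:E) ν,
      (x, v) ∈ expDomainIn G U := by
    simp only [expRadius, lt_iSup_iff] at hν'
    obtain ⟨τ, ⟨hτ, hsub⟩, hlt⟩ := hν'
    intro x hx v hv
    refine hsub ⟨by rwa [closure_ball _ hr.ne'], ?_⟩
    exact Metric.closedBall_subset_ball ((ENNReal.ofReal_lt_ofReal_iff hτ).1 hlt) hv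
  have hball : Metric.ball (0:E) r ⊆ Metric.closedBall 0 r := Metric.ball_subset_closedBall
  have hsm : ∀ x ∈ Metric.closedBall (0:E) r, ∀ v ∈ Metric.closedBall (0:E) ν,
      ContDiffAt ℝ ∞ (expIn G U) (x, v) := fun x hx v hv =>
    (hG.expDomainIn_mem_nhds (hDom x hx v hv)).2
  have h0r : (0:E) ∈ Metric.ball (0:E) r := Metric.mem_ball_self hr
  have h0ν : (0:E) ∈ Metric.closedBall (0:E) ν := Metric.mem_closedBall_self hν.le
  have hXm : ∀ x ∈ Metric.ball (0:E) r, X x ∈ Metric.closedBall (0:E) ν := fun x hx => by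
    simpa using hXν x hx
  have hX0e : ∀ x ∈ Metric.ball (0:E) r,
      ENNReal.ofReal ‖X x‖ ≤ supNormDeriv X (Metric.ball 0 r) 0 := fun x hx => by
    rw [← norm_iteratedFDeriv_zero (𝕜 := ℝ) (f := X), ofReal_norm]
    exact enorm_iteratedFDeriv_le_supNormDeriv X 0 hx
  -- the displacement of the center
  have hcenter : ‖expIn G U (0, X 0)‖ ≤ ε * r / 2 := by
    set B := expBoundFst G (Metric.ball 0 r) U ν with hB
    -- An infinite bound would make the quotient in the hypothesis zero, which no quantity is
    -- strictly below.
    have hBtop : B ≠ ⊤ := by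
      intro h
      rw [h] at h1
      simp at h1
    have hBb : ∀ y ∈ Metric.closedBall (0:E) ν,
        ‖fderiv ℝ (fun y => expIn G U (0, y)) y‖ ≤ B.toReal := fun y hy => by
      rw [← norm_iteratedFDeriv_one]
      refine norm_iteratedFDeriv_le_of_supNormDeriv_le (S := Metric.closedBall 0 ν) ENNReal.toReal_nonneg ?_ hy
      rw [ENNReal.ofReal_toReal hBtop]
      exact le_iSup₂ (f := fun x (_ : x ∈ closure (Metric.ball (0:E) r)) =>
        supNormDeriv (fun y : E => expIn G U (x, y)) (Metric.closedBall 0 ν) 1) 0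
        (subset_closure h0r)
    have hmv := (convex_closedBall (0:E) ν).norm_image_sub_le_of_norm_fderiv_le (𝕜 := ℝ)
      (f := fun y => expIn G U (0, y)) (fun y hy => by
        have hz := ((hsm 0 (hball h0r) y hy).differentiableAt (by simp))
        exact DifferentiableAt.comp (g := expIn G U) y hz (by fun_prop)) hBb h0ν (hXm 0 h0r)
    rw [hG.expIn_zero (hDom 0 (hball h0r) 0 h0ν), sub_zero, sub_zero] at hmv
    refine hmv.trans ?_
    have h4 : ENNReal.ofReal ‖X 0‖ * (2 * B) ≤ ENNReal.ofReal (ε * r) :=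
      (mul_le_mul_left (hX0e 0 h0r) _).trans (ENNReal.mul_le_of_le_div h1.le)
    have h5 := ENNReal.toReal_mono ENNReal.ofReal_ne_top h4
    rw [ENNReal.toReal_mul, ENNReal.toReal_mul, ENNReal.toReal_ofReal (norm_nonneg _),
      ENNReal.toReal_ofReal (by positivity)] at h5
    simp only [ENNReal.toReal_ofNat] at h5
    linarith
  -- the second derivative
  have hsecond : ∀ x ∈ Metric.ball (0:E) r,
      ‖fderiv ℝ (expIn G U) (x, X x) - fderiv ℝ (expIn G U) (x, 0)‖ ≤ ε / 4 := by
    intro x hx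
    set B := expBoundSnd G (Metric.ball 0 r) U ν with hB
    have hBtop : B ≠ ⊤ := by
      intro h
      rw [h] at h3
      simp at h3
    have hBb : ∀ q ∈ {x} ×ˢ Metric.closedBall (0:E) ν,
        ‖fderiv ℝ (fderiv ℝ (expIn G U)) q‖ ≤ B.toReal := fun q hq => by
      rw [norm_fderiv_fderiv_eq]
      refine norm_iteratedFDeriv_le_of_supNormDeriv_le
        (S := closure (Metric.ball (0:E) r) ×ˢ Metric.closedBall 0 ν) ENNReal.toReal_nonneg ?_
        ⟨subset_closure (by rw [show q.1 = x from hq.1]; exact hx), hq.2⟩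
      rw [ENNReal.ofReal_toReal hBtop]
      exact le_rfl
    -- Only the base-point-fixed slice is needed: the segment from `(x, 0)` to `(x, X x)` stays in
    -- this convex set.
    have hmv := ((convex_singleton x).prod
      (convex_closedBall (0:E) ν)).norm_image_sub_le_of_norm_fderiv_le (𝕜 := ℝ)
      (f := fderiv ℝ (expIn G U)) (fun q hq => by
        have hz := hsm x (hball hx) q.2 hq.2
        have hq' : (x, q.2) = q := Prod.ext (show q.1 = x from hq.1).symm rfl
        rw [hq'] at hz
        exact (hz.fderiv_right (m := 1) (by norm_cast)).differentiableAt one_ne_zero)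
      hBb (x := (x, 0)) (y := (x, X x)) ⟨rfl, h0ν⟩ ⟨rfl, hXm x hx⟩
    refine hmv.trans ?_
    have hn : ‖(x, X x) - (x, (0:E))‖ = ‖X x‖ := by simp
    rw [hn]
    have h4 : ENNReal.ofReal ‖X x‖ * (4 * (B + 1)) ≤ ENNReal.ofReal ε :=
      (mul_le_mul_left (hX0e x hx) _).trans (ENNReal.mul_le_of_le_div h3.le)
    have h5 := ENNReal.toReal_mono ENNReal.ofReal_ne_top h4
    rw [ENNReal.toReal_mul, ENNReal.toReal_mul, ENNReal.toReal_ofReal (norm_nonneg _),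
      ENNReal.toReal_ofReal hε.le, ENNReal.toReal_add hBtop ENNReal.one_ne_top] at h5
    simp only [ENNReal.toReal_ofNat, ENNReal.toReal_one] at h5
    nlinarith [norm_nonneg (X x)]
  have hφ : ContDiffOn ℝ k (fun x => expIn G U (x, X x)) (Metric.ball 0 r) := by
    intro x hx
    have hz : ContDiffAt ℝ k (expIn G U) (x, X x) :=
      (hsm x (hball hx) (X x) (hXm x hx)).of_le (by exact_mod_cast le_top)
    exact ContDiffAt.comp_contDiffWithinAt (f := fun x => (x, X x)) x hz
      (contDiffWithinAt_id.prodMk (hX x hx))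
  have hφ' : ∀ x ∈ Metric.ball (0:E) r,
      ‖fderiv ℝ (fun x => expIn G U (x, X x)) x - ContinuousLinearMap.id ℝ E‖ ≤ ε / 2 := by
    intro x hx
    have hXx : HasFDerivAt X (fderiv ℝ X x) x :=
      ((hX.differentiableOn hk0).differentiableAt (Metric.isOpen_ball.mem_nhds hx)).hasFDerivAt
    have hex : HasFDerivAt (expIn G U) (fderiv ℝ (expIn G U) (x, X x)) (x, X x) :=
      ((hsm x (hball hx) (X x) (hXm x hx)).differentiableAt (by simp)).hasFDerivAt
    have hcomp : HasFDerivAt (fun x => expIn G U (x, X x))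
        ((fderiv ℝ (expIn G U) (x, X x)).comp ((ContinuousLinearMap.id ℝ E).prod (fderiv ℝ X x))) x :=
      HasFDerivAt.comp (f := fun x => (x, X x)) x hex ((hasFDerivAt_id x).prodMk hXx)
    rw [hcomp.fderiv]
    refine ContinuousLinearMap.opNorm_le_bound _ (by positivity) fun h => ?_
    have hX' : ‖fderiv ℝ X x h‖ ≤ ε / 4 * ‖h‖ := (fderiv ℝ X x).le_of_opNorm_le (hXd x hx) h
    -- Subtracting `D exp (x, 0) (h, DX h) = h + DX h` isolates the part controlled by the second
    -- derivative.
    have e1 : ((fderiv ℝ (expIn G U) (x, X x)).comp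
        ((ContinuousLinearMap.id ℝ E).prod (fderiv ℝ X x)) - ContinuousLinearMap.id ℝ E) h =
        (fderiv ℝ (expIn G U) (x, X x) - fderiv ℝ (expIn G U) (x, 0)) (h, fderiv ℝ X x h)
          + fderiv ℝ X x h := by
      rw [sub_apply, sub_apply,
        hG.fderiv_expIn_zero (hDom x (hball hx) 0 h0ν)]
      simp only [ContinuousLinearMap.comp_apply, ContinuousLinearMap.prod_apply,
        ContinuousLinearMap.id_apply]
      abel
    rw [e1]
    -- The maximum norm on the product matters: `‖DX h‖ ≤ ‖h‖`, so the pair costs no extra constant.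
    have h6 : ‖(h, fderiv ℝ X x h)‖ ≤ ‖h‖ :=
      max_le le_rfl (hX'.trans (by nlinarith [norm_nonneg h]))
    have h7 := (fderiv ℝ (expIn G U) (x, X x) - fderiv ℝ (expIn G U) (x, 0)).le_of_opNorm_le
      (hsecond x hx) (h, fderiv ℝ X x h)
    have h8 : ε / 4 * ‖(h, fderiv ℝ X x h)‖ ≤ ε / 4 * ‖h‖ := by gcongr
    refine (norm_add_le _ _).trans ?_
    linarith
  obtain ⟨hΦ, hsub⟩ := exists_partialDiffeomorph_ball (half_pos hε) (by linarith) hk hφ hφ'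
  refine ⟨fun x hx => hDom x (hball hx) _ (hXm x hx), hΦ, Subset.trans ?_ hsub⟩
  -- The radii fit because `(1 - 2ε) r + ε r / 2 ≤ (1 - ε / 2) r`.
  refine Metric.ball_subset_ball' ?_
  rw [dist_zero_left]
  nlinarith [hcenter, mul_pos hε hr]

end Estimates

/-! ### Invariance of the geodesic equation under changes of coordinates -/

section Invariance

variable {E : Type v} [NormedAddCommGroup E] [NormedSpace ℝ E]
  {G G' : E → E →L[ℝ] E →L[ℝ] ℝ}

theorem GeodesicEqAt.congr_of_eventuallyEq {γ σ : ℝ → E} {t : ℝ} (h : GeodesicEqAt G γ t)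
    (hσ : σ =ᶠ[𝓝 t] γ) : GeodesicEqAt G σ t := by
  intro w
  rw [hσ.deriv.deriv_eq, hσ.deriv_eq, hσ.eq_of_nhds]
  exact h w

/-- Differentiating the pullback formula produces terms in the second derivative of `ψ`. By symmetry
of `G'` and of the second derivative the mixed `(u, w)` terms cancel, and only the `(u, u)` term
survives. -/
theorem christoffelFirst_pullback {ψ : E → E} {x : E} (hψ : ContDiffAt ℝ 2 ψ x)
    (hG : DifferentiableAt ℝ G x) (hG' : DifferentiableAt ℝ G' (ψ x))
    (hsymm : ∀ a b, G' (ψ x) a b = G' (ψ x) b a)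
    (hpull : ∀ᶠ y in 𝓝 x, ∀ a b, G y a b = G' (ψ y) (fderiv ℝ ψ y a) (fderiv ℝ ψ y b)) (u w : E) :
    christoffelFirst G x u u w =
      christoffelFirst G' (ψ x) (fderiv ℝ ψ x u) (fderiv ℝ ψ x u) (fderiv ℝ ψ x w)
        + G' (ψ x) (fderiv ℝ (fderiv ℝ ψ) x u u) (fderiv ℝ ψ x w) := by
  have hψ1 : HasFDerivAt ψ (fderiv ℝ ψ x) x := (hψ.differentiableAt (by simp)).hasFDerivAt
  have hψ2 : HasFDerivAt (fderiv ℝ ψ) (fderiv ℝ (fderiv ℝ ψ) x) x :=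
    ((hψ.fderiv_right (m := 1) (by norm_num)).differentiableAt (by simp)).hasFDerivAt
  have hsym2 : ∀ a b, fderiv ℝ (fderiv ℝ ψ) x a b = fderiv ℝ (fderiv ℝ ψ) x b a :=
    (hψ.isSymmSndFDerivAt (by simp)).eq
  have key : ∀ a b c, fderiv ℝ G x a b c =
      fderiv ℝ G' (ψ x) (fderiv ℝ ψ x a) (fderiv ℝ ψ x b) (fderiv ℝ ψ x c)
        + G' (ψ x) (fderiv ℝ (fderiv ℝ ψ) x a b) (fderiv ℝ ψ x c)
        + G' (ψ x) (fderiv ℝ ψ x b) (fderiv ℝ (fderiv ℝ ψ) x a c) := by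
    intro a b c
    have h1 : HasFDerivAt (fun y => G y b c) _ x :=
      (hG.hasFDerivAt.clm_apply (hasFDerivAt_const b x)).clm_apply (hasFDerivAt_const c x)
    have h2 : HasFDerivAt (fun y => G' (ψ y) (fderiv ℝ ψ y b) (fderiv ℝ ψ y c)) _ x :=
      ((hG'.hasFDerivAt.comp x hψ1).clm_apply
        (hψ2.clm_apply (hasFDerivAt_const b x))).clm_apply (hψ2.clm_apply (hasFDerivAt_const c x))
    have h3 := h2.congr_of_eventuallyEq (hpull.mono fun y hy => hy b c)
    have h4 := DFunLike.congr_fun (h1.unique h3) a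
    simp at h4
    rw [h4]
    ring
  simp only [christoffelFirst, key]
  rw [hsym2 w u, hsymm (fderiv ℝ ψ x u) (fderiv ℝ (fderiv ℝ ψ) x u w)]
  ring

/-- The acceleration of `ψ ∘ γ` gains the second derivative of `ψ` on `(γ', γ')`, exactly the
correction in the Christoffel symbol. Surjectivity of the differential turns every test vector into
an image. -/
theorem GeodesicEqAt.comp {ψ : E → E} {γ : ℝ → E} {t : ℝ} (h : GeodesicEqAt G γ t)
    (hγ : ContDiffAt ℝ 2 γ t) (hψ : ContDiffAt ℝ 2 ψ (γ t))
    (hψs : Function.Surjective (fderiv ℝ ψ (γ t)))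
    (hG : DifferentiableAt ℝ G (γ t)) (hG' : DifferentiableAt ℝ G' (ψ (γ t)))
    (hsymm : ∀ a b, G' (ψ (γ t)) a b = G' (ψ (γ t)) b a)
    (hpull : ∀ᶠ y in 𝓝 (γ t), ∀ a b, G y a b = G' (ψ y) (fderiv ℝ ψ y a) (fderiv ℝ ψ y b)) :
    GeodesicEqAt G' (ψ ∘ γ) t := by
  have hd1 : deriv (ψ ∘ γ) =ᶠ[𝓝 t] fun s => fderiv ℝ ψ (γ s) (deriv γ s) := by
    filter_upwards [hγ.eventually (by simp),
      hγ.continuousAt.eventually (hψ.eventually (by simp))] with s hs hs'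
    exact ((hs'.differentiableAt (by simp)).hasFDerivAt.comp_hasDerivAt s
      (hs.differentiableAt (by simp)).hasDerivAt).deriv
  have hγ1 : HasDerivAt γ (deriv γ t) t := (hγ.differentiableAt (by simp)).hasDerivAt
  have hγ2 : HasDerivAt (deriv γ) (deriv (deriv γ) t) t :=
    ((hγ.derivWithin (m := 1) (by norm_num)).differentiableAt (by simp)).hasDerivAt
  have hψ2 : HasFDerivAt (fderiv ℝ ψ) (fderiv ℝ (fderiv ℝ ψ) (γ t)) (γ t) :=
    ((hψ.fderiv_right (m := 1) (by norm_num)).differentiableAt (by simp)).hasFDerivAt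
  have hd2 : deriv (deriv (ψ ∘ γ)) t = fderiv ℝ (fderiv ℝ ψ) (γ t) (deriv γ t) (deriv γ t)
      + fderiv ℝ ψ (γ t) (deriv (deriv γ) t) := by
    rw [hd1.deriv_eq]
    exact ((hψ2.comp_hasDerivAt t hγ1).clm_apply hγ2).deriv
  intro w'
  obtain ⟨w, rfl⟩ := hψs w'
  have h1 := h w
  rw [christoffelFirst_pullback hψ hG hG' hsymm hpull, hpull.self_of_nhds] at h1
  rw [hd2, hd1.eq_of_nhds, map_add, add_apply]
  simp only [Function.comp_apply]
  linarith

end Invariance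

/-! ### Charts of a Riemannian manifold -/

section Charts

variable {E : Type v} [NormedAddCommGroup E] [NormedSpace ℝ E]
  {M : Type u} [TopologicalSpace M] [ChartedSpace E M] [IsManifold 𝓘(ℝ, E) ∞ M]
  {κ κ' : OpenPartialHomeomorph M E}

theorem mdifferentiable_of_mem_maximalAtlas (hκ : κ ∈ IsManifold.maximalAtlas 𝓘(ℝ, E) ∞ M) :
    κ.MDifferentiable 𝓘(ℝ, E) 𝓘(ℝ, E) :=
  ⟨(contMDiffOn_of_mem_maximalAtlas hκ).mdifferentiableOn (by simp),
    (contMDiffOn_symm_of_mem_maximalAtlas hκ).mdifferentiableOn (by simp)⟩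

/-- The differential of a chart, as an operator on the model space. -/
def chartDeriv (κ : OpenPartialHomeomorph M E) (x : M) : E →L[ℝ] E :=
  mfderiv 𝓘(ℝ, E) 𝓘(ℝ, E) κ x

/-- The differential of the inverse of a chart, as an operator on the model space. -/
def chartSymmDeriv (κ : OpenPartialHomeomorph M E) (y : E) : E →L[ℝ] E :=
  mfderiv 𝓘(ℝ, E) 𝓘(ℝ, E) κ.symm y

/-- The value of a metric at a point, as a bilinear form on the model space. -/
def metricForm (g : SmoothMetric E M) (x : M) : E →L[ℝ] E →L[ℝ] ℝ := g.inner x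

theorem chartSymmDeriv_chartDeriv (hκ : κ ∈ IsManifold.maximalAtlas 𝓘(ℝ, E) ∞ M) {x : M}
    (hx : x ∈ κ.source) (v : E) : chartSymmDeriv κ (κ x) (chartDeriv κ x v) = v :=
  DFunLike.congr_fun ((mdifferentiable_of_mem_maximalAtlas hκ).symm_comp_deriv hx) v

theorem chartDeriv_chartSymmDeriv (hκ : κ ∈ IsManifold.maximalAtlas 𝓘(ℝ, E) ∞ M) {y : E}
    (hy : y ∈ κ.target) (v : E) : chartDeriv κ (κ.symm y) (chartSymmDeriv κ y v) = v :=
  DFunLike.congr_fun ((mdifferentiable_of_mem_maximalAtlas hκ).comp_symm_deriv hy) v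

theorem localMetric_apply (g : SmoothMetric E M) (κ : OpenPartialHomeomorph M E) (y a b : E) :
    localMetric g κ y a b =
      metricForm g (κ.symm y) (chartSymmDeriv κ y a) (chartSymmDeriv κ y b) := rfl

theorem metricForm_symm (g : SmoothMetric E M) (x : M) (a b : E) :
    metricForm g x a b = metricForm g x b a := g.symm x a b

theorem metricForm_pos (g : SmoothMetric E M) (x : M) {a : E} (ha : a ≠ 0) :
    0 < metricForm g x a a := g.pos x a ha

theorem contMDiffOn_chartSymmDeriv (hκ : κ ∈ IsManifold.maximalAtlas 𝓘(ℝ, E) ∞ M) (a : E) :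
    ContMDiffOn 𝓘(ℝ, E) 𝓘(ℝ, E).tangent ∞
      (fun y => (⟨κ.symm y, chartSymmDeriv κ y a⟩ : TangentBundle 𝓘(ℝ, E) M)) κ.target := by
  have h1 := (contMDiffOn_symm_of_mem_maximalAtlas hκ).contMDiffOn_tangentMapWithin (m := ∞)
    (by simp) κ.open_target.uniqueMDiffOn
  have h2 : ContMDiff 𝓘(ℝ, E) 𝓘(ℝ, E).tangent ∞
      (fun y : E => (⟨y, (a : E)⟩ : TangentBundle 𝓘(ℝ, E) E)) :=
    contMDiff_vectorSpace_iff_contDiff.2 contDiff_const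
  refine (h1.comp h2.contMDiffOn fun y hy => hy).congr fun y hy => ?_
  simp only [Function.comp_apply, tangentMapWithin]
  rw [mfderivWithin_of_isOpen κ.open_target hy]
  rfl

/-- In finite dimension it suffices to test on constant vectors `a`, `b`; these push forward to
smooth sections of the tangent bundle along `κ.symm`, on which the metric is evaluated. -/
theorem contDiffOn_localMetric [FiniteDimensional ℝ E] (g : SmoothMetric E M)
    (hκ : κ ∈ IsManifold.maximalAtlas 𝓘(ℝ, E) ∞ M) :
    ContDiffOn ℝ ∞ (localMetric g κ) κ.target := by
  rw [contDiffOn_clm_apply]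
  intro a
  rw [contDiffOn_clm_apply]
  intro b
  rw [← contMDiffOn_iff_contDiffOn]
  intro y hy
  have h := ContMDiffWithinAt.clm_bundle_apply₂ (F₁ := E) (F₂ := E) (F₃ := ℝ)
    (E₃ := Bundle.Trivial M ℝ)
    (ψ := fun y => g.inner (κ.symm y))
    ((g.contMDiff (κ.symm y)).comp_contMDiffWithinAt y
      (contMDiffOn_symm_of_mem_maximalAtlas hκ y hy))
    (contMDiffOn_chartSymmDeriv hκ a y hy) (contMDiffOn_chartSymmDeriv hκ b y hy)
  rw [contMDiffWithinAt_totalSpace] at h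
  exact h.2

theorem isRiemannianOn_localMetric [FiniteDimensional ℝ E] (g : SmoothMetric E M)
    (hκ : κ ∈ IsManifold.maximalAtlas 𝓘(ℝ, E) ∞ M) :
    IsRiemannianOn (localMetric g κ) κ.target where
  isOpen := κ.open_target
  contDiffOn := contDiffOn_localMetric g hκ
  symm x _ v w := by
    rw [localMetric_apply, localMetric_apply, metricForm_symm]
  pos x hx v hv := by
    rw [localMetric_apply]
    refine metricForm_pos g _ fun h0 => hv ?_
    rw [← chartDeriv_chartSymmDeriv hκ hx v, h0, map_zero]

theorem contDiffOn_localVectorField {k : ℕ∞}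
    (hκ : κ ∈ IsManifold.maximalAtlas 𝓘(ℝ, E) ∞ M) {X : ∀ x : M, TangentSpace 𝓘(ℝ, E) x}
    (hX : ContMDiff 𝓘(ℝ, E) 𝓘(ℝ, E).tangent k
      (fun x => (⟨x, X x⟩ : TangentBundle 𝓘(ℝ, E) M))) :
    ContDiffOn ℝ k (localVectorField κ X) κ.target := by
  have hk : (k : WithTop ℕ∞) ≤ ((⊤ : ℕ∞) : WithTop ℕ∞) := by exact_mod_cast le_top
  have h1 : ContMDiffOn 𝓘(ℝ, E).tangent 𝓘(ℝ, E).tangent ∞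
      (tangentMapWithin 𝓘(ℝ, E) 𝓘(ℝ, E) κ κ.source) (TotalSpace.proj ⁻¹' κ.source) :=
    (contMDiffOn_of_mem_maximalAtlas hκ).contMDiffOn_tangentMapWithin
      (by simp) κ.open_source.uniqueMDiffOn
  have h2 : ContMDiffOn 𝓘(ℝ, E) 𝓘(ℝ, E).tangent k
      (fun y => (⟨κ.symm y, X (κ.symm y)⟩ : TangentBundle 𝓘(ℝ, E) M)) κ.target :=
    hX.comp_contMDiffOn ((contMDiffOn_symm_of_mem_maximalAtlas hκ).of_le hk)
  have h3 := (h1.of_le hk).comp h2 fun y hy => κ.map_target hy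
  rw [← contMDiffOn_iff_contDiffOn]
  refine (((contMDiff_snd_tangentBundle_modelSpace E 𝓘(ℝ, E) (n := (∞ : WithTop ℕ∞))).of_le hk).comp_contMDiffOn
    h3).congr fun y hy => ?_
  change localVectorField κ X y =
    mfderivWithin 𝓘(ℝ, E) 𝓘(ℝ, E) κ κ.source (κ.symm y) (X (κ.symm y))
  rw [mfderivWithin_of_isOpen κ.open_source (κ.map_target hy)]
  rfl

theorem fderiv_transition (hκ : κ ∈ IsManifold.maximalAtlas 𝓘(ℝ, E) ∞ M)
    (hκ' : κ' ∈ IsManifold.maximalAtlas 𝓘(ℝ, E) ∞ M)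
    {y : E} (hy : y ∈ κ.target) (hy' : κ.symm y ∈ κ'.source) (a : E) :
    fderiv ℝ (κ' ∘ κ.symm) y a = chartDeriv κ' (κ.symm y) (chartSymmDeriv κ y a) := by
  rw [← mfderiv_eq_fderiv, mfderiv_comp y
    ((mdifferentiable_of_mem_maximalAtlas hκ').mdifferentiableAt hy')
    ((mdifferentiable_of_mem_maximalAtlas hκ).mdifferentiableAt_symm hy)]
  rfl

theorem fderiv_transition_surjective (hκ : κ ∈ IsManifold.maximalAtlas 𝓘(ℝ, E) ∞ M)
    (hκ' : κ' ∈ IsManifold.maximalAtlas 𝓘(ℝ, E) ∞ M)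
    {y : E} (hy : y ∈ κ.target) (hy' : κ.symm y ∈ κ'.source) :
    Function.Surjective (fderiv ℝ (κ' ∘ κ.symm) y) := by
  intro w
  refine ⟨chartDeriv κ (κ.symm y) (chartSymmDeriv κ' (κ' (κ.symm y)) w), ?_⟩
  have h1 := chartSymmDeriv_chartDeriv hκ (κ.map_target hy) (chartSymmDeriv κ' (κ' (κ.symm y)) w)
  have h2 := chartDeriv_chartSymmDeriv hκ' (κ'.map_source hy') w
  rw [κ.right_inv hy] at h1
  rw [κ'.left_inv hy'] at h2
  rw [fderiv_transition hκ hκ' hy hy', h1, h2]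

/-- The transition map between two charts relates the localizations of the metric. -/
theorem localMetric_transition (g : SmoothMetric E M)
    (hκ : κ ∈ IsManifold.maximalAtlas 𝓘(ℝ, E) ∞ M) (hκ' : κ' ∈ IsManifold.maximalAtlas 𝓘(ℝ, E) ∞ M)
    {y : E} (hy : y ∈ κ.target) (hy' : κ.symm y ∈ κ'.source) (a b : E) :
    localMetric g κ y a b = localMetric g κ' ((κ' ∘ κ.symm) y)
      (fderiv ℝ (κ' ∘ κ.symm) y a) (fderiv ℝ (κ' ∘ κ.symm) y b) := by
  rw [localMetric_apply, localMetric_apply, fderiv_transition hκ hκ' hy hy',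
    fderiv_transition hκ hκ' hy hy', Function.comp_apply, chartSymmDeriv_chartDeriv hκ' hy',
    chartSymmDeriv_chartDeriv hκ' hy', κ'.left_inv hy']

theorem contDiffAt_transition (hκ : κ ∈ IsManifold.maximalAtlas 𝓘(ℝ, E) ∞ M)
    (hκ' : κ' ∈ IsManifold.maximalAtlas 𝓘(ℝ, E) ∞ M)
    {y : E} (hy : y ∈ κ.target) (hy' : κ.symm y ∈ κ'.source) :
    ContDiffAt ℝ ∞ (κ' ∘ κ.symm) y := by
  rw [← contMDiffAt_iff_contDiffAt]
  exact ((contMDiffOn_of_mem_maximalAtlas hκ').contMDiffAt (κ'.open_source.mem_nhds hy')).comp y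
    ((contMDiffOn_symm_of_mem_maximalAtlas hκ).contMDiffAt (κ.open_target.mem_nhds hy))

end Charts

/-! ### Geodesics of a Riemannian manifold -/

section Geodesics

theorem two_le_infty : (2 : WithTop ℕ∞) ≤ ((⊤ : ℕ∞) : WithTop ℕ∞) := 
  show ((2 : ℕ∞) : WithTop ℕ∞) ≤ _ from WithTop.coe_le_coe.2 le_top

variable {E : Type v} [NormedAddCommGroup E] [NormedSpace ℝ E]
  {M : Type u} [TopologicalSpace M] [ChartedSpace E M] [IsManifold 𝓘(ℝ, E) ∞ M]
  {κ : OpenPartialHomeomorph M E} {g : SmoothMetric E M}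

/-- Geodesics of `M` must satisfy the equation in every chart; one chart is enough because
transition maps are isometries of the localized metrics. -/
theorem isGeodesicOn_symm_comp [FiniteDimensional ℝ E] (hκ : κ ∈ IsManifold.maximalAtlas 𝓘(ℝ, E) ∞ M)
    {γ : ℝ → E} {J : Set ℝ} (hJ : IsOpen J) (hm : MapsTo γ J κ.target) (hc : ContDiffOn ℝ 2 γ J)
    (hg : ∀ t ∈ J, GeodesicEqAt (localMetric g κ) γ t) : IsGeodesicOn g (κ.symm ∘ γ) J := by
  refine ⟨((contMDiffOn_symm_of_mem_maximalAtlas hκ).of_le two_le_infty).comp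
    (contMDiffOn_iff_contDiffOn.2 hc) hm, fun κ' hκ' t ht hs => ?_⟩
  have hy := hm ht
  have hy' : κ.symm (γ t) ∈ κ'.source := hs
  have hG := isRiemannianOn_localMetric g hκ
  have hG' := isRiemannianOn_localMetric g hκ'
  have hψ := contDiffAt_transition hκ hκ' hy hy'
  have hev : ∀ᶠ y in 𝓝 (γ t), y ∈ κ.target ∧ κ.symm y ∈ κ'.source :=
    (κ.open_target.eventually_mem hy).and
      ((κ.continuousAt_symm hy).eventually_mem (κ'.open_source.mem_nhds hy'))
  exact (hg t ht).comp (ψ := κ' ∘ κ.symm) (hc.contDiffAt (hJ.mem_nhds ht)) (hψ.of_le two_le_infty)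
    (fderiv_transition_surjective hκ hκ' hy hy')
    ((hG.contDiffOn.differentiableOn (by simp)).differentiableAt (hG.isOpen.mem_nhds hy))
    ((hG'.contDiffOn.differentiableOn (by simp)).differentiableAt
      (hG'.isOpen.mem_nhds (κ'.map_source hy')))
    (hG'.symm _ (κ'.map_source hy'))
    (hev.mono fun y hy a b => localMetric_transition g hκ hκ' hy.1 hy.2 a b)

variable (M) in
/-- The tangent vector with given base point and given value in the preferred trivialization. -/
def tangentPoint (x : M) (v : E) : TangentBundle 𝓘(ℝ, E) M := ⟨x, v⟩

theorem tangentMap_chart_symm_tangentPoint (κ : OpenPartialHomeomorph M E) (y w : E) :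
    tangentMap 𝓘(ℝ, E) 𝓘(ℝ, E) κ.symm (tangentPoint E y w) =
      tangentPoint M (κ.symm y) (chartSymmDeriv κ y w) := rfl

theorem tangentMap_curve (γ : ℝ → E) (t : ℝ) :
    tangentMap 𝓘(ℝ, ℝ) 𝓘(ℝ, E) γ (tangentPoint ℝ t (1 : ℝ)) = tangentPoint E (γ t) (deriv γ t) := by
  rw [← fderiv_apply_one_eq_deriv, ← mfderiv_eq_fderiv]
  rfl

theorem isGeodesicFrom_symm_comp [FiniteDimensional ℝ E]
    (hκ : κ ∈ IsManifold.maximalAtlas 𝓘(ℝ, E) ∞ M) {γ : ℝ → E} {x : M} (hx : x ∈ κ.source)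
    {v : E} (h : IsGeodesicFromIn (localMetric g κ) κ.target (κ x, chartDeriv κ x v) γ) :
    IsGeodesicFrom g (tangentPoint M x v) (κ.symm ∘ γ) := by
  obtain ⟨h0, h0', d, hd, hm, hc, hg⟩ := h
  refine ⟨?_, d, hd, isGeodesicOn_symm_comp hκ isOpen_Ioo hm hc hg⟩
  have h0J : (0:ℝ) ∈ Ioo (-d) (1 + d) := ⟨by linarith, by linarith⟩
  have hγd : DifferentiableAt ℝ γ 0 :=
    (hc.contDiffAt (isOpen_Ioo.mem_nhds h0J)).differentiableAt (by simp)
  refine (tangentMap_comp_at (I' := 𝓘(ℝ, E)) (tangentPoint ℝ 0 (1:ℝ))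
    ((mdifferentiable_of_mem_maximalAtlas hκ).mdifferentiableAt_symm (hm h0J))
    hγd.mdifferentiableAt).trans ?_
  rw [tangentMap_curve, h0, h0', tangentMap_chart_symm_tangentPoint,
    chartSymmDeriv_chartDeriv hκ hx, κ.left_inv hx]

theorem deriv_chart_comp_eq {γ : ℝ → M} {t : ℝ}
    (hκ : κ ∈ IsManifold.maximalAtlas 𝓘(ℝ, E) ∞ M) (ht : γ t ∈ κ.source)
    (hγ : MDifferentiableAt 𝓘(ℝ, ℝ) 𝓘(ℝ, E) γ t) :
    deriv (κ ∘ γ) t = (tangentMap 𝓘(ℝ, E) 𝓘(ℝ, E) κ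
      (tangentMap 𝓘(ℝ, ℝ) 𝓘(ℝ, E) γ ⟨t, (1:ℝ)⟩)).2 := by
  have h1 := tangentMap_comp_at (I' := 𝓘(ℝ, E)) (⟨t, (1:ℝ)⟩ : TangentBundle 𝓘(ℝ, ℝ) ℝ)
    ((mdifferentiable_of_mem_maximalAtlas hκ).mdifferentiableAt ht) hγ
  refine Eq.trans ?_ (congrArg (fun p : TangentBundle 𝓘(ℝ, E) E => (p.2 : E)) h1)
  simp only [tangentMap]
  rw [mfderiv_eq_fderiv, ← fderiv_apply_one_eq_deriv]
  rfl

theorem IsGeodesicOn.contDiffAt_chart_comp {γ : ℝ → M} {J : Set ℝ} (hJ : IsOpen J)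
    (h : IsGeodesicOn g γ J) (hκ : κ ∈ IsManifold.maximalAtlas 𝓘(ℝ, E) ∞ M) {t : ℝ} (ht : t ∈ J)
    (hs : γ t ∈ κ.source) : ContDiffAt ℝ 2 (κ ∘ γ) t := by
  rw [← contMDiffAt_iff_contDiffAt]
  exact (((contMDiffOn_of_mem_maximalAtlas hκ).contMDiffAt (κ.open_source.mem_nhds hs)).of_le
    two_le_infty).comp t (h.1.contMDiffAt (hJ.mem_nhds ht))

theorem IsGeodesicOn.eventuallyEq [FiniteDimensional ℝ E] {γ₁ γ₂ : ℝ → M} {J : Set ℝ}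
    (hJ : IsOpen J) (h₁ : IsGeodesicOn g γ₁ J) (h₂ : IsGeodesicOn g γ₂ J)
    (hκ : κ ∈ IsManifold.maximalAtlas 𝓘(ℝ, E) ∞ M) {t : ℝ} (ht : t ∈ J) (hs : γ₁ t ∈ κ.source)
    (heq : γ₁ t = γ₂ t) (heq' : deriv (κ ∘ γ₁) t = deriv (κ ∘ γ₂) t) : γ₁ =ᶠ[𝓝 t] γ₂ := by
  have key : ∀ γ : ℝ → M, IsGeodesicOn g γ J → γ t ∈ κ.source → ∀ᶠ s in 𝓝 t, γ s ∈ κ.source ∧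
      ContDiffAt ℝ 2 (κ ∘ γ) s ∧ GeodesicEqAt (localMetric g κ) (κ ∘ γ) s := by
    intro γ hγ hγt
    filter_upwards [hJ.mem_nhds ht, (hγ.1.contMDiffAt (hJ.mem_nhds ht)).continuousAt.eventually_mem
      (κ.open_source.mem_nhds hγt)] with s hs hs'
    exact ⟨hs', hγ.contDiffAt_chart_comp hJ hκ hs hs', hγ.2 κ hκ s hs hs'⟩
  have k₁ := key γ₁ h₁ hs
  have k₂ := key γ₂ h₂ (heq ▸ hs)
  have h := (isRiemannianOn_localMetric g hκ).eventuallyEq_geodesic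
    (k₁.mono fun s hs => hs.2) (k₂.mono fun s hs => hs.2) (κ.map_source hs)
    (congrArg κ heq) heq'
  filter_upwards [k₁, k₂, h] with s h1 h2 h3
  exact κ.injOn h1.1 h2.1 h3

/-- The times around which both curves agree form an open set. It is also closed in the interval:
positions agree in the limit since `M` is Hausdorff, velocities agree by continuity in a chart, and
local uniqueness applies again. -/
theorem IsGeodesicOn.eqOn_Ioo [FiniteDimensional ℝ E] [T2Space M] {γ₁ γ₂ : ℝ → M} {a b t₀ : ℝ}
    (h₁ : IsGeodesicOn g γ₁ (Ioo a b)) (h₂ : IsGeodesicOn g γ₂ (Ioo a b)) (ht₀ : t₀ ∈ Ioo a b)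
    (heq : tangentMap 𝓘(ℝ, ℝ) 𝓘(ℝ, E) γ₁ ⟨t₀, (1:ℝ)⟩ = tangentMap 𝓘(ℝ, ℝ) 𝓘(ℝ, E) γ₂ ⟨t₀, (1:ℝ)⟩) :
    EqOn γ₁ γ₂ (Ioo a b) := by
  have hc : ∀ γ : ℝ → M, IsGeodesicOn g γ (Ioo a b) → ∀ t ∈ Ioo a b,
      ContMDiffAt 𝓘(ℝ, ℝ) 𝓘(ℝ, E) 2 γ t := fun γ hγ t ht => hγ.1.contMDiffAt (isOpen_Ioo.mem_nhds ht)
  refine eqOn_Ioo_of_eventuallyEq ht₀ ?_ fun t ht hfr => ?_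
  · have hp : γ₁ t₀ = γ₂ t₀ := congrArg TotalSpace.proj heq
    have hκ := IsManifold.chart_mem_maximalAtlas (I := 𝓘(ℝ, E)) (n := ∞) (γ₁ t₀)
    have hs := mem_chart_source E (γ₁ t₀)
    refine h₁.eventuallyEq isOpen_Ioo h₂ hκ ht₀ hs hp ?_
    rw [deriv_chart_comp_eq hκ hs ((hc γ₁ h₁ t₀ ht₀).mdifferentiableAt (by simp)),
      deriv_chart_comp_eq hκ (hp ▸ hs) ((hc γ₂ h₂ t₀ ht₀).mdifferentiableAt (by simp)), heq]
  · have hp : γ₁ t = γ₂ t := by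
      by_contra hne
      exact hfr (((hc γ₁ h₁ t ht).continuousAt.ne_iff_eventually_ne
        (hc γ₂ h₂ t ht).continuousAt).1 hne |>.mono fun s hs h => hs h.self_of_nhds)
    have hκ := IsManifold.chart_mem_maximalAtlas (I := 𝓘(ℝ, E)) (n := ∞) (γ₁ t)
    have hs := mem_chart_source E (γ₁ t)
    refine h₁.eventuallyEq isOpen_Ioo h₂ hκ ht hs hp ?_
    have hd : ∀ γ : ℝ → M, IsGeodesicOn g γ (Ioo a b) → γ t ∈ (chartAt E (γ₁ t)).source →
        ContinuousAt (deriv (chartAt E (γ₁ t) ∘ γ)) t := fun γ hγ hγs =>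
      ((hγ.contDiffAt_chart_comp isOpen_Ioo hκ ht hγs).derivWithin (m := 1)
        (by norm_num)).continuousAt
    by_contra hne
    exact hfr (((hd γ₁ h₁ hs).ne_iff_eventually_ne (hd γ₂ h₂ (hp ▸ hs))).1 hne |>.mono
      fun s hs h => hs (h.fun_comp _).deriv_eq)

theorem riemannExp_eq [FiniteDimensional ℝ E] [T2Space M] {v : TangentBundle 𝓘(ℝ, E) M}
    {γ : ℝ → M} (h : IsGeodesicFrom g v γ) : riemannExp g v = γ 1 := by
  have hex : ∃ γ : ℝ → M, IsGeodesicFrom g v γ := ⟨γ, h⟩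
  rw [riemannExp, dif_pos hex]
  obtain ⟨h1, d, hd, hg⟩ := hex.choose_spec
  obtain ⟨h1', d', hd', hg'⟩ := h
  have hm : 0 < min d d' := lt_min hd hd'
  have hres : ∀ (γ : ℝ → M) (e : ℝ), min d d' ≤ e → IsGeodesicOn g γ (Ioo (-e) (1 + e)) →
      IsGeodesicOn g γ (Ioo (-min d d') (1 + min d d')) := fun γ e he hγ =>
    have hsub := Ioo_subset_Ioo (neg_le_neg he) (add_le_add_right he 1)
    ⟨hγ.1.mono hsub, fun κ hκ t ht => hγ.2 κ hκ t (hsub ht)⟩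
  exact (hres _ d (min_le_left _ _) hg).eqOn_Ioo (hres _ d' (min_le_right _ _) hg') (t₀ := 0)
    ⟨by linarith, by linarith⟩ (h1.trans h1'.symm) ⟨by linarith, by linarith⟩

theorem riemannExp_mem_connectedComponent [FiniteDimensional ℝ E] [T2Space M]
    {v : TangentBundle 𝓘(ℝ, E) M} (h : v ∈ expDomain g) :
    riemannExp g v ∈ connectedComponent v.proj := by
  obtain ⟨γ, hγ⟩ := h
  rw [riemannExp_eq hγ]
  obtain ⟨h0, d, hd, hg⟩ := hγ
  have h00 : γ 0 = v.proj := congrArg TotalSpace.proj h0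
  have hconn : IsPreconnected (γ '' Ioo (-d) (1 + d)) := isPreconnected_Ioo.image γ hg.1.continuousOn
  exact hconn.subset_connectedComponent ⟨0, ⟨by linarith, by linarith⟩, h00⟩
    ⟨1, ⟨by linarith, by linarith⟩, rfl⟩

/-- In a chart, the map `exp ∘ X` is computed by the exponential map of the localized metric. -/
theorem expField_symm_eq [FiniteDimensional ℝ E] [T2Space M]
    (hκ : κ ∈ IsManifold.maximalAtlas 𝓘(ℝ, E) ∞ M) {X : ∀ x : M, TangentSpace 𝓘(ℝ, E) x} {y : E}
    (hy : y ∈ κ.target)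
    (hD : (y, localVectorField κ X y) ∈ expDomainIn (localMetric g κ) κ.target) :
    (⟨κ.symm y, X (κ.symm y)⟩ : TangentBundle 𝓘(ℝ, E) M) ∈ expDomain g ∧
      expIn (localMetric g κ) κ.target (y, localVectorField κ X y) ∈ κ.target ∧
      expField g X (κ.symm y) =
        κ.symm (expIn (localMetric g κ) κ.target (y, localVectorField κ X y)) := by
  obtain ⟨γ, hγ⟩ := hD
  have h := isGeodesicFrom_symm_comp (g := g) (γ := γ) hκ (κ.map_target hy) (v := X (κ.symm y))
    (by rw [κ.right_inv hy]; exact hγ)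
  rw [(isRiemannianOn_localMetric g hκ).expIn_eq hγ]
  refine ⟨⟨_, h⟩, ?_, riemannExp_eq h⟩
  obtain ⟨-, -, d, hd, hm, -⟩ := hγ
  exact hm ⟨by linarith, by linarith⟩

end Geodesics

/-! ### Covering maps with finitely many sheets -/

section Covering

theorem IsCoveringMap.isLocallyConstant_encard_fiber {Y Z : Type*} [TopologicalSpace Y]
    [TopologicalSpace Z] {f : Y → Z} (hf : IsCoveringMap f) :
    IsLocallyConstant fun z => (f ⁻¹' {z}).encard := by
  rw [IsLocallyConstant.iff_exists_open]
  intro z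
  obtain ⟨hI, U, hzU, hU, hfU, H, hH⟩ := id (hf z)
  refine ⟨U, hU, hzU, fun z' hz' => ?_⟩
  -- The trivialization around `z` serves every nearby `z'` with the same model fibre.
  have h' : IsEvenlyCovered f z' (f ⁻¹' {z}) := ⟨hI, U, hz', hU, hfU, H, hH⟩
  exact (Set.encard_congr h'.fiberHomeomorph.toEquiv).symm

/-- A proper surjective local homeomorphism onto a connected space is a covering map with a constant
finite number of sheets. -/
theorem IsProperMap.isCoveringMap_and_encard_fiber {Y Z : Type*} [TopologicalSpace Y] [T2Space Y]
    [TopologicalSpace Z] [ConnectedSpace Z] {f : Y → Z} (hf : IsProperMap f)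
    (hloc : IsLocalHomeomorph f) (hsurj : Function.Surjective f) :
    IsCoveringMap f ∧ ∃ n : ℕ, 0 < n ∧ ∀ z, (f ⁻¹' {z}).encard = n := by
  -- Fibres are compact by properness and discrete by local injectivity.
  have hfin : ∀ z, (f ⁻¹' {z}).Finite := fun z =>
    (hf.isCompact_preimage isCompact_singleton).finite
      (.of_openPartialHomeomorph f subset_rfl fun e _ => by
        obtain ⟨φ, hφ, h⟩ := hloc e
        exact ⟨φ, hφ, h.symm⟩)
  have hcov : IsCoveringMap f := by
    rw [isCoveringMap_iff_isCoveringMapOn_univ]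
    exact hf.isClosedMap.isCoveringMapOn_of_isLocalHomeomorphOn (fun z _ => hfin z)
      (hloc.isLocalHomeomorphOn (s := _))
  obtain ⟨z₀⟩ : Nonempty Z := inferInstance
  refine ⟨hcov, (f ⁻¹' {z₀}).ncard, ?_, fun z => ?_⟩
  · rw [Set.ncard_pos (hfin z₀)]
    exact hsurj z₀
  · rw [(hfin z₀).cast_ncard_eq]
    exact hcov.isLocallyConstant_encard_fiber.apply_eq_of_preconnectedSpace z z₀

end Covering

/-! ### Local diffeomorphisms and properness read off in charts -/

section LocalDiffeo

variable {E : Type v} [NormedAddCommGroup E] [NormedSpace ℝ E]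
  {M : Type u} [TopologicalSpace M] [ChartedSpace E M] [IsManifold 𝓘(ℝ, E) ∞ M]

/-- A chart as a partial diffeomorphism. -/
def chartPartialDiffeomorph (κ : OpenPartialHomeomorph M E)
    (hκ : κ ∈ IsManifold.maximalAtlas 𝓘(ℝ, E) ∞ M) (k : ℕ∞) :
    PartialDiffeomorph 𝓘(ℝ, E) 𝓘(ℝ, E) M E k :=
  ⟨κ.toPartialEquiv, κ.open_source, κ.open_target,
    (contMDiffOn_of_mem_maximalAtlas hκ).of_le (WithTop.coe_le_coe.2 le_top),
    (contMDiffOn_symm_of_mem_maximalAtlas hκ).of_le (WithTop.coe_le_coe.2 le_top)⟩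

theorem isLocalDiffeomorphAt_of_chart {κ : OpenPartialHomeomorph M E}
    (hκ : κ ∈ IsManifold.maximalAtlas 𝓘(ℝ, E) ∞ M) {k : ℕ∞} {f : M → M}
    (Φ : PartialDiffeomorph 𝓘(ℝ, E) 𝓘(ℝ, E) E E k) (hΦ : Φ.source ⊆ κ.target)
    (hf : ∀ y ∈ Φ.source, Φ y ∈ κ.target ∧ f (κ.symm y) = κ.symm (Φ y)) {y : E}
    (hy : y ∈ Φ.source) : IsLocalDiffeomorphAt 𝓘(ℝ, E) 𝓘(ℝ, E) k f (κ.symm y) := by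
  let C := chartPartialDiffeomorph κ hκ k
  refine ⟨(C.trans Φ).trans C.symm, ?_, ?_⟩
  · have hs := κ.map_target (hΦ hy)
    have hr := κ.right_inv (hΦ hy)
    refine ⟨⟨hs, ?_⟩, ?_⟩
    · change κ (κ.symm y) ∈ Φ.source
      rwa [hr]
    · change Φ (κ (κ.symm y)) ∈ κ.target
      rw [hr]
      exact (hf y hy).1
  · rintro z ⟨⟨hz, hz'⟩, -⟩
    change f z = κ.symm (Φ (κ z))
    rw [← (hf (κ z) hz').2, κ.left_inv hz]

end LocalDiffeo

/-- A compact `K` meets finitely many chart domains. A point of `f ⁻¹' K` in the smaller ball of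
chart `i` is mapped into both that chart domain and `K`, so the preimage is a closed subset of a
finite union of compact chart balls. -/
theorem isProperMap_of_locallyFinite_charts
    {E : Type v} [NormedAddCommGroup E] [NormedSpace ℝ E] [FiniteDimensional ℝ E]
    {M : Type u} [TopologicalSpace M] [T2Space M] [ChartedSpace E M]
    {ι : Type w} {κ : ι → OpenPartialHomeomorph M E} {r r' : ι → ℝ}
    (hball : ∀ i, Metric.closedBall (0 : E) (r i) ⊆ (κ i).target) (hr : ∀ i, r' i < r i)
    (hlf : LocallyFinite fun i => (κ i).source)
    (hcover : ⋃ i, (κ i).symm '' Metric.ball (0 : E) (r' i) = univ) {f : M → M} (hf : Continuous f)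
    (hmaps : ∀ i, MapsTo f ((κ i).symm '' Metric.ball (0 : E) (r i)) (κ i).source) :
    IsProperMap f := by
  have : ProperSpace E := FiniteDimensional.proper_real E
  have : LocallyCompactSpace M := ChartedSpace.locallyCompactSpace E M
  rw [isProperMap_iff_isCompact_preimage]
  refine ⟨hf, fun K hK => ?_⟩
  have hfin := hlf.finite_nonempty_inter_compact hK
  have hcomp : IsCompact (⋃ i ∈ {i | ((κ i).source ∩ K).Nonempty},
      (κ i).symm '' Metric.closedBall (0 : E) (r' i)) := by
    refine hfin.isCompact_biUnion fun i _ => ?_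
    refine (isCompact_closedBall (0 : E) (r' i)).image_of_continuousOn ((κ i).continuousOn_symm.mono ?_)
    exact (Metric.closedBall_subset_closedBall (hr i).le).trans (hball i)
  refine hcomp.of_isClosed_subset (hK.isClosed.preimage hf) fun x hx => ?_
  obtain ⟨i, hi⟩ := mem_iUnion.1 (hcover ▸ mem_univ x)
  have hi' := image_mono (Metric.ball_subset_ball (hr i).le) hi
  exact mem_biUnion (show i ∈ {i | ((κ i).source ∩ K).Nonempty} from ⟨f x, hmaps i hi', hx⟩)
    (image_mono Metric.ball_subset_closedBall hi)

end

/-! ### Global conclusions for `exp ∘ X` -/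

theorem mainTheorem4
    {E : Type v} [NormedAddCommGroup E] [NormedSpace ℝ E] [FiniteDimensional ℝ E] [Nontrivial E]
    {M : Type u} [TopologicalSpace M] [T2Space M] [ChartedSpace E M] [IsManifold 𝓘(ℝ, E) ∞ M]
    (g : SmoothMetric E M)
    {ι : Type w} (κ : ι → OpenPartialHomeomorph M E)
    (hκ : ∀ i, κ i ∈ IsManifold.maximalAtlas 𝓘(ℝ, E) ∞ M)
    (r ν ε : ι → ℝ)
    (hr : ∀ i, 0 < r i)
    (hball : ∀ i, Metric.closedBall (0 : E) (r i) ⊆ (κ i).target)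
    (hcover : ⋃ i, (κ i).symm '' Metric.ball (0 : E) (r i) = univ)
    (hν : ∀ i, 0 < ν i ∧ ENNReal.ofReal (ν i) <
      expRadius (localMetric g (κ i)) (Metric.ball 0 (r i)) (κ i).target)
    (hε : ∀ i, 0 < ε i ∧ ε i < 1 / 2)
    (k : ℕ∞) (hk : 1 ≤ k)
    (X : ∀ x : M, TangentSpace 𝓘(ℝ, E) x)
    (hX : ContMDiff 𝓘(ℝ, E) 𝓘(ℝ, E).tangent k
      (fun x => (⟨x, X x⟩ : TangentBundle 𝓘(ℝ, E) M)))
    (hX0 : ∀ i, supNormDeriv (localVectorField (κ i) X) (Metric.ball 0 (r i)) 0 <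
      min (ENNReal.ofReal (ε i * r i) /
            (2 * expBoundFst (localMetric g (κ i)) (Metric.ball 0 (r i)) (κ i).target (ν i)))
        (min (ENNReal.ofReal (ν i))
          (ENNReal.ofReal (ε i) /
            (4 * (expBoundSnd (localMetric g (κ i)) (Metric.ball 0 (r i)) (κ i).target (ν i)
              + 1)))))
    (hX1 : ∀ i, supNormDeriv (localVectorField (κ i) X) (Metric.ball 0 (r i)) 1 <
      ENNReal.ofReal (ε i / 4)) :
    -- the image of `X` lies in the domain of the exponential map, and components are preserved
    ((∀ x, (⟨x, X x⟩ : TangentBundle 𝓘(ℝ, E) M) ∈ expDomain g) ∧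
      (∀ x, MapsTo (expField g X) (connectedComponent x) (connectedComponent x)) ∧
      -- on each chart ball, a `C^k`-diffeomorphism onto an open image containing a shrunken ball
      ∀ i,
        MapsTo (expField g X) ((κ i).symm '' Metric.ball 0 (r i)) (κ i).source ∧
        (∃ Φ : PartialDiffeomorph 𝓘(ℝ, E) 𝓘(ℝ, E) E E k,
          Φ.source = Metric.ball 0 (r i) ∧
          EqOn (κ i ∘ expField g X ∘ (κ i).symm) Φ (Metric.ball 0 (r i))) ∧
        Metric.ball 0 (r i * (1 - 2 * ε i)) ⊆
          (κ i ∘ expField g X ∘ (κ i).symm) '' Metric.ball 0 (r i)) ∧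
    -- bound on the number of preimages
    (∀ y, Cardinal.lift.{w} (Cardinal.mk (expField g X ⁻¹' {y})) ≤
      Cardinal.lift.{u} (Cardinal.mk {i : ι | y ∈ (κ i).source})) ∧
    (ConnectedSpace M → LocallyFinite (fun i => (κ i).source) →
      ∀ r' : ι → ℝ, ⋃ i, (κ i).symm '' Metric.ball (0 : E) (r' i) = univ →
        ((∀ i, r' i < (1 - ε i) * r i) → IsProperMap (expField g X)) ∧
        ((∀ i, r' i < (1 - 2 * ε i) * r i) →
          (IsCoveringMap (expField g X) ∧
            ∃ n : ℕ, 0 < n ∧ ∀ y, (expField g X ⁻¹' {y}).encard = n) ∧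
          ((∃ p : M, ∃! i, p ∈ (κ i).source) →
            ∃ Φ : Diffeomorph 𝓘(ℝ, E) 𝓘(ℝ, E) M M k, ⇑Φ = expField g X))) := by
  have hbt : ∀ i, Metric.ball (0 : E) (r i) ⊆ (κ i).target := fun i =>
    Metric.ball_subset_closedBall.trans (hball i)
  have hloc := fun i => (isRiemannianOn_localMetric g (hκ i)).expField_ball (hr i) (hν i).1 (hν i).2
    (hε i).1 (hε i).2 hk ((contDiffOn_localVectorField (hκ i) hX).mono (hbt i)) (hX0 i) (hX1 i)
  have hexp := fun i y (hy : y ∈ Metric.ball (0 : E) (r i)) =>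
    expField_symm_eq (g := g) (hκ i) (hbt i hy) ((hloc i).1 y hy)
  have hcov : ∀ x, ∃ i, ∃ y ∈ Metric.ball (0 : E) (r i), (κ i).symm y = x := fun x => by
    obtain ⟨i, y, hy⟩ := mem_iUnion.1 (hcover ▸ mem_univ x)
    exact ⟨i, y, hy⟩
  have hdom : ∀ x, (⟨x, X x⟩ : TangentBundle 𝓘(ℝ, E) M) ∈ expDomain g := fun x => by
    obtain ⟨i, y, hy, rfl⟩ := hcov x
    exact (hexp i y hy).1
  have hmaps : ∀ i, MapsTo (expField g X) ((κ i).symm '' Metric.ball 0 (r i)) (κ i).source := by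
    rintro i _ ⟨y, hy, rfl⟩
    rw [(hexp i y hy).2.2]
    exact (κ i).map_target (hexp i y hy).2.1
  have hchart : ∀ i, EqOn (κ i ∘ expField g X ∘ (κ i).symm) (fun y => expIn (localMetric g (κ i))
      (κ i).target (y, localVectorField (κ i) X y)) (Metric.ball 0 (r i)) := fun i y hy => by
    simp only [Function.comp_apply]
    rw [(hexp i y hy).2.2, (κ i).right_inv (hexp i y hy).2.1]
  have hΦ : ∀ i, ∃ Φ : PartialDiffeomorph 𝓘(ℝ, E) 𝓘(ℝ, E) E E k, Φ.source = Metric.ball 0 (r i) ∧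
      EqOn (κ i ∘ expField g X ∘ (κ i).symm) Φ (Metric.ball 0 (r i)) := fun i => by
    obtain ⟨Φ, hs, he⟩ := (hloc i).2.1
    exact ⟨Φ, hs, (hchart i).trans he⟩
  have hsub : ∀ i, Metric.ball 0 (r i * (1 - 2 * ε i)) ⊆
      (κ i ∘ expField g X ∘ (κ i).symm) '' Metric.ball 0 (r i) := fun i => by
    rw [(hchart i).image_eq]
    exact (hloc i).2.2
  have hinj : ∀ i, InjOn (expField g X) ((κ i).symm '' Metric.ball 0 (r i)) := by
    rintro i _ ⟨y, hy, rfl⟩ _ ⟨z, hz, rfl⟩ h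
    obtain ⟨Φ, hs, he⟩ := hΦ i
    have h1 : Φ y = Φ z := by
      rw [← he hy, ← he hz]
      exact congrArg (κ i) h
    rw [Φ.injOn (hs ▸ hy) (hs ▸ hz) h1]
  -- Each preimage is sent to a chart whose ball contains it. That chart domain also contains `y`,
  -- and two preimages with the same chart coincide by injectivity on its ball.
  have hcard : ∀ y, Nonempty ((expField g X ⁻¹' {y}) ↪ {i : ι | y ∈ (κ i).source}) := by
    intro y
    choose i z hz hzx using hcov
    refine ⟨⟨fun x => ⟨i x, ?_⟩, fun x x' h => ?_⟩⟩
    · have := hmaps (i x) ⟨z x, hz x, hzx x⟩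
      rwa [show expField g X x = y from x.2] at this
    · have hi : i x = i x' := congrArg Subtype.val h
      refine Subtype.ext (hinj (i x) ⟨z x, hz x, hzx x⟩ ?_ (x.2.trans x'.2.symm))
      rw [hi]
      exact ⟨z x', hz x', hzx x'⟩
  have hdiffeo : IsLocalDiffeomorph 𝓘(ℝ, E) 𝓘(ℝ, E) k (expField g X) := by
    intro x
    obtain ⟨i, y, hy, rfl⟩ := hcov x
    obtain ⟨Φ, hs, he⟩ := hΦ i
    refine isLocalDiffeomorphAt_of_chart (hκ i) Φ (hs ▸ hbt i) (fun z hz => ?_) (hs ▸ hy)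
    rw [hs] at hz
    have hz' := hmaps i ⟨z, hz, rfl⟩
    rw [← he hz]
    exact ⟨(κ i).map_source hz', ((κ i).left_inv hz').symm⟩
  have hcont : Continuous (expField g X) := hdiffeo.contMDiff.continuous
  refine ⟨⟨hdom, fun x z hz => ?_, fun i => ⟨hmaps i, hΦ i, hsub i⟩⟩,
    fun y => Cardinal.lift_mk_le'.2 (hcard y), fun hconn hlf r' hr' => ⟨fun hlt => ?_, fun hlt => ?_⟩⟩
  · rw [connectedComponent_eq hz]
    exact riemannExp_mem_connectedComponent (hdom z)
  · refine isProperMap_of_locallyFinite_charts hball (fun i => (hlt i).trans ?_) hlf hr' hcont hmaps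
    nlinarith [hr i, hε i]
  · have hproper : IsProperMap (expField g X) := by
      refine isProperMap_of_locallyFinite_charts hball (fun i => (hlt i).trans ?_) hlf hr' hcont hmaps
      nlinarith [hr i, hε i]
    have hsurj : Function.Surjective (expField g X) := by
      intro x
      obtain ⟨i, y, hy, rfl⟩ := mem_iUnion.1 (hr' ▸ mem_univ x)
      -- The smaller balls cover `M` and lie in the images of the chart balls, whence surjectivity.
      obtain ⟨z, hz, hzy⟩ := hsub i (Metric.ball_subset_ball (mul_comm (r i) _ ▸ (hlt i).le) hy)
      refine ⟨(κ i).symm z, ?_⟩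
      rw [← hzy]
      exact ((κ i).left_inv (hmaps i ⟨z, hz, rfl⟩)).symm
    have hcover' := hproper.isCoveringMap_and_encard_fiber hdiffeo.isLocalHomeomorph hsurj
    refine ⟨hcover', ?_⟩
    rintro ⟨p, i, hi, huniq⟩
    obtain ⟨-, n, hn, hcount⟩ := hcover'
    have hp : (expField g X ⁻¹' {p}).Subsingleton := by
      obtain ⟨e⟩ := hcard p
      intro a ha b hb
      have := e.injective (a₁ := ⟨a, ha⟩) (a₂ := ⟨b, hb⟩) (Subtype.ext
        ((huniq _ (e ⟨a, ha⟩).2).trans (huniq _ (e ⟨b, hb⟩).2).symm))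
      exact congrArg Subtype.val this
    -- The fibre over the point in a single chart domain has at most one element, and all fibres
    -- have equal cardinality.
    have hn1 : (n : ℕ∞) ≤ 1 := hcount p ▸ Set.encard_le_one_iff_subsingleton.2 hp
    have hinj' : Function.Injective (expField g X) := fun a b hab =>
      Set.encard_le_one_iff_subsingleton.1 ((hcount (expField g X b)).le.trans hn1) hab rfl
    exact ⟨hdiffeo.diffeomorphOfBijective ⟨hinj', hsurj⟩, rfl⟩
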